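/- Let $A$ be a Hilbert space of finite dimension $d_A\ge 1$, let $B_1,\dots,B_n$ be Hilbert spaces (possibly infinite-dimensional), and let $\Lambda$ be a completely positive trace-preserving linear map from the operators on $A$ to the trace-class operators on $B_1\otimes\cdots\otimes B_n$. For $j\in\{1,\dots,n\}$ let $\Lambda_j:=\mathrm{tr}_{\backslash B_j}\circ\Lambda$, where $\mathrm{tr}_{\backslash B_j}$ is the partial trace over all factors except $B_j$, and fix $\delta>0$. For a linear map $\Phi$ from the operators on $A$ to the trace-class operators on $B_j$ put $$\|\Phi\|_\Diamond:=\sup_{X\neq 0}\frac{\|(\Phi\otimes\mathrm{id})(X)\|_1}{\|X\|_1},\qquad \|Y\|_1:=\mathrm{tr}\big((Y^\dagger Y)^{1/2}\big),$$ the supremum being over all finite-dimensional ancillas $R$ and all non-zero operators $X$ on $A\otimes R$. Then there exist a finite POVM $\{M_k\}_k$ on $A$ (that is, $M_k\ge 0$ and $\sum_k M_k=I$), not depending on $j$, and a set $S\subseteq\{1,\dots,n\}$ with $|S|\ge(1-\delta)n$, such that for every $j\in S$ there are states (density operators) $\sigma_{j,k}$ on $B_j$ with $$\|\Lambda_j-\mathcal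 E_j\|_\Diamond\le\left(\frac{27\,\ln(2)\,d_A^6\,\log_2(d_A)}{n\,\delta^3}\right)^{1/3},\qquad \mathcal E_j(X):=\sum_k\mathrm{tr}(M_kX)\,\sigma_{j,k}.$$ -/

import Mathlib

open scoped ENNReal ComplexOrder lp CStarAlgebra

noncomputable section

namespace QDarwinism

/-- Bounded operators on the Hilbert space with an orthonormal basis labelled by `ι`, realised as
`ℓ²(ι)`. The label set may be infinite, of any cardinality; for `ι = Fin d` this is the algebra of
operators of a `d`-dimensional system. The Hilbert space tensor product of `ℓ²(ι)` and `ℓ²(κ)` is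
`ℓ²(ι × κ)`, and that of a finite family `ℓ²(ι j)` is `ℓ²(∀ j, ι j)`. -/
abbrev Op (ι : Type*) : Type _ := ℓ²(ι, ℂ) →L[ℂ] ℓ²(ι, ℂ)

variable {ι κ : Type*}

/-- The standard basis vector `e_i` of `ℓ²(ι)`. -/
def ket (i : ι) : ℓ²(ι, ℂ) := by
  classical exact lp.single 2 i (1 : ℂ)

/-- The absolute value `|T| = (T† T)^{1/2}` of a bounded operator on a Hilbert space. -/
def absOp {H : Type*} [NormedAddCommGroup H] [InnerProductSpace ℂ H] [CompleteSpace H]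
    (T : H →L[ℂ] H) : H →L[ℂ] H := CFC.abs T

/-- The trace norm `‖T‖₁ = tr ((T† T)^{1/2})`, with value `∞` if `T` is not trace class. -/
def traceNorm (T : Op ι) : ℝ≥0∞ :=
  ∑' i, ENNReal.ofReal (inner ℂ (ket i) (absOp T (ket i))).re

/-- `T` is trace class. -/
def IsTraceClass (T : Op ι) : Prop := traceNorm T ≠ ∞

/-- The trace `∑ i, ⟨e_i, T e_i⟩`; the series converges absolutely when `T` is trace class. -/
def trace (T : Op ι) : ℂ := ∑' i, inner ℂ (ket i) (T (ket i))

/-- Density operators: positive trace-class operators of trace one. -/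
def IsState (σ : Op ι) : Prop := 0 ≤ σ ∧ IsTraceClass σ ∧ trace σ = 1

/-- POVMs with finitely many outcomes. -/
def IsPOVM {m : ℕ} (M : Fin m → Op ι) : Prop := (∀ k, 0 ≤ M k) ∧ ∑ k, M k = 1

/-- A map from the operators of a finite-dimensional system is trace preserving: it takes values in
the trace class and preserves the trace. -/
def IsTracePreserving (Φ : Op ι → Op κ) : Prop :=
  ∀ X, IsTraceClass (Φ X) ∧ trace (Φ X) = trace X

lemma memlp_comp (f : ι → κ) (hf : Function.Injective f) (x : ℓ²(κ, ℂ)) :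
    Memℓp (fun i => x (f i)) 2 := by
  have hx := (memℓp_gen_iff (p := 2) (by norm_num)).1 (lp.memℓp x)
  exact memℓp_gen (hx.comp_injective hf)

/-- For an injective map `f` of labels, the restriction `(x_k)_k ↦ (x_{f i})_i`. Its adjoint is the
isometry `e_i ↦ e_{f i}`. -/
def restrict (f : ι → κ) (hf : Function.Injective f) : ℓ²(κ, ℂ) →L[ℂ] ℓ²(ι, ℂ) :=
  LinearMap.mkContinuous
    { toFun := fun x => ⟨fun i => x (f i), memlp_comp f hf x⟩
      map_add' := fun _ _ => rfl
      map_smul' := fun _ _ => rfl }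
    1 (by
      intro x
      rw [one_mul]
      refine lp.norm_le_of_tsum_le (p := 2) (by norm_num) (norm_nonneg x) ?_
      rw [lp.norm_rpow_eq_tsum (p := 2) (by norm_num) x]
      have hx := (memℓp_gen_iff (p := 2) (by norm_num)).1 (lp.memℓp x)
      exact (hx.comp_injective hf).tsum_le_tsum_of_inj f hf
        (fun c _ => by positivity) (fun i => le_rfl) hx)

/-- `1 ⊗ ⟨a|`, from `ℓ²(ι) ⊗ ℂᵏ` to `ℓ²(ι)`. -/
def ancillaBra {k : ℕ} (a : Fin k) : ℓ²(ι × Fin k, ℂ) →L[ℂ] ℓ²(ι, ℂ) :=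
  restrict (fun i => (i, a)) (Prod.mk_left_injective a)

/-- The map `Φ ⊗ id` with a `k`-dimensional ancilla:
`(Φ ⊗ id) (∑ a b, X a b ⊗ |a⟩⟨b|) = ∑ a b, Φ (X a b) ⊗ |a⟩⟨b|`. -/
def ampliation (k : ℕ) (Φ : Op ι → Op κ) (X : Op (ι × Fin k)) : Op (κ × Fin k) :=
  ∑ a, ∑ b, (ancillaBra a).adjoint ∘L
    Φ (ancillaBra a ∘L X ∘L (ancillaBra b).adjoint) ∘L ancillaBra b

/-- The diamond norm: the supremum of `‖(Φ ⊗ id) X‖₁ / ‖X‖₁` over all finite-dimensional ancillas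
and all operators `X` (`X = 0` contributes `0 / 0 = 0`). -/
def diamondNorm {d : ℕ} (Φ : Op (Fin d) → Op κ) : ℝ≥0∞ :=
  ⨆ (k : ℕ) (X : Op (Fin d × Fin k)), traceNorm (ampliation k Φ X) / traceNorm X

section Composite

variable {n : ℕ} {β : Fin n → Type*}

/-- The label of the composite system with label `b` in position `j` and labels `c` elsewhere. -/
def insertLabel (j : Fin n) (c : ∀ i : {i : Fin n // i ≠ j}, β i) (b : β j) : ∀ i, β i :=
  (Equiv.piSplitAt j β).symm (b, c)

lemma insertLabel_injective (j : Fin n) (c : ∀ i : {i : Fin n // i ≠ j}, β i) :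
    Function.Injective (insertLabel j c) := fun _ _ h =>
  congrArg Prod.fst ((Equiv.piSplitAt j β).symm.injective h)

/-- `1_{B_j} ⊗ ⟨c|`, where `c` labels a product basis vector of all the factors except `B_j`. -/
def restBra (j : Fin n) (c : ∀ i : {i : Fin n // i ≠ j}, β i) :
    ℓ²(∀ i, β i, ℂ) →L[ℂ] ℓ²(β j, ℂ) :=
  restrict (insertLabel j c) (insertLabel_injective j c)

/-- The partial trace over all factors except `B_j`: `∑ c, (1 ⊗ ⟨c|) T (1 ⊗ |c⟩)`. The series
converges absolutely when `T` is trace class. -/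
def marginal (j : Fin n) (T : Op (∀ i, β i)) : Op (β j) :=
  ∑' c, restBra j c ∘L T ∘L (restBra j c).adjoint

end Composite

/-- The measure-and-prepare map `X ↦ ∑ k, tr (M k X) σ k`. -/
def measurePrepare {m : ℕ} (M : Fin m → Op ι) (σ : Fin m → Op κ) (X : Op ι) : Op κ :=
  ∑ k, trace (M k * X) • σ k

end QDarwinism

end

open scoped ENNReal ComplexOrder lp CStarAlgebra

noncomputable section

namespace QDarwinism

variable {ι κ : Type*}

/-! ### Basis expansions, Hilbert-Schmidt norms, approximate polar decomposition -/

section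

variable {H : Type*} [NormedAddCommGroup H] [InnerProductSpace ℂ H] [CompleteSpace H]

/-! Pull a measurement `N` of some of the subsystems back through Λ: it becomes a POVM on A with
effects `E_k`, where tr(`E_k` X) = tr(`N_k` Λ(X)). Its potential is the sum of ‖`E_k`‖²/tr `E_k`
(Hilbert-Schmidt norms). It lies between 0 and d, because ‖E‖ ≤ tr E for E ≥ 0 and the traces sum to
d.

Let j be an unmeasured subsystem and `σ_k` the state of `B_j` conditioned on outcome k when the
input is maximally mixed. Suppose a self-adjoint contraction K on `B_j` and a matrix unit X show
that `Λ_j`(X) and the sum of tr(`E_k` X) `σ_k` differ by more than ε. Then measuring (1 ± K)/2 as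
well raises the potential by at least ε²/d, by the convexity gap of (m, t) ↦ ‖m‖²/t
(`sq_div_add_sq_div_le`, `IsProbe.sq_norm_trace_le`). Hence adding such subsystems one at a time
stops with a measured set C of size at most d²/ε², and one POVM serves every j outside C
(`exists_probe_forall_norm_trace_le`).

Testing with self-adjoint contractions costs a factor 2 (`traceNorm_le_of_isSelfAdjoint`), and
passing from matrix units to the diamond norm costs a factor d (`diamondNorm_le_of_matrixUnit`).
With ε = η/(2d) this gives |C| ≤ 4d⁴/η², which for the stated bound η is at most δn
(`card_le_of_mul_sq_le`).

In infinite dimension, trace-norm estimates come from duality with contractions through a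
regularised polar decomposition, and partial traces are handled on the span of positive trace-class
operators. -/

lemma inner_ket_left (i : ι) (x : ℓ²(ι, ℂ)) : inner ℂ (ket i) x = x i := by
  classical
  have h : ket i = lp.single 2 i (1 : ℂ) := by unfold ket; congr
  rw [h, lp.inner_single_left]
  simp

lemma ket_apply [DecidableEq ι] (i j : ι) : ket i j = if j = i then (1 : ℂ) else 0 := by
  have h : ket i = lp.single 2 i (1 : ℂ) := by unfold ket; congr!
  rw [h, lp.coeFn_single, Pi.single_apply]

lemma norm_ket (i : ι) : ‖ket i‖ = 1 := by
  classical
  have h : ket i = lp.single 2 i (1 : ℂ) := by unfold ket; congr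
  rw [h, lp.norm_single (by norm_num)]
  simp

lemma hasSum_norm_sq (x : ℓ²(ι, ℂ)) : HasSum (fun i => ‖x i‖ ^ 2) (‖x‖ ^ 2) := by
  have h := lp.hasSum_norm (p := 2) (by norm_num) x
  simpa using h

lemma ofReal_norm_sq (x : ℓ²(ι, ℂ)) :
    ENNReal.ofReal (‖x‖ ^ 2) = ∑' i, ENNReal.ofReal (‖x i‖ ^ 2) := by
  rw [← (hasSum_norm_sq x).tsum_eq,
    ENNReal.ofReal_tsum_of_nonneg (fun i => by positivity) (hasSum_norm_sq x).summable]

lemma hasSum_ket (x : ℓ²(ι, ℂ)) : HasSum (fun i => x i • ket i) x := by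
  classical
  have h := lp.hasSum_single (p := 2) (by norm_num) x
  have h' : (fun i => x i • ket i) = fun i => lp.single 2 i (x i) := by
    ext1 i
    ext1
    ext j
    rw [lp.coeFn_smul, Pi.smul_apply, ket_apply, lp.coeFn_single, Pi.single_apply]
    aesop
  rwa [h']

lemma clm_ext {F : Type*} [NormedAddCommGroup F] [NormedSpace ℂ F] {A B : ℓ²(ι, ℂ) →L[ℂ] F}
    (h : ∀ i, A (ket i) = B (ket i)) : A = B := by
  ext x
  have hA := (hasSum_ket x).mapL A
  have hB := (hasSum_ket x).mapL B
  simp only [map_smul, h] at hA hB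
  exact hA.unique hB

/-- The square of the Hilbert-Schmidt norm. -/
def hsSq (A : ℓ²(ι, ℂ) →L[ℂ] H) : ℝ≥0∞ := ∑' i, ENNReal.ofReal (‖A (ket i)‖ ^ 2)

lemma hsSq_adjoint (A : ℓ²(ι, ℂ) →L[ℂ] ℓ²(κ, ℂ)) : hsSq A.adjoint = hsSq A := by
  unfold hsSq
  simp_rw [ofReal_norm_sq]
  rw [ENNReal.tsum_comm]
  congr! 5 with i m
  rw [← inner_ket_left, ← inner_ket_left m, ContinuousLinearMap.adjoint_inner_right,
    ← inner_conj_symm, RCLike.norm_conj]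

omit [CompleteSpace H] in
lemma hsSq_comp_le {H' : Type*} [NormedAddCommGroup H'] [InnerProductSpace ℂ H']
    (B : H →L[ℂ] H') (A : ℓ²(ι, ℂ) →L[ℂ] H) :
    hsSq (B ∘L A) ≤ ENNReal.ofReal (‖B‖ ^ 2) * hsSq A := by
  unfold hsSq
  rw [← ENNReal.tsum_mul_left]
  gcongr with i
  rw [← ENNReal.ofReal_mul (by positivity), ← mul_pow]
  gcongr
  exact B.le_opNorm _

lemma hsSq_comp_le' (A : ℓ²(ι, ℂ) →L[ℂ] ℓ²(κ, ℂ)) {μ : Type*} (B : ℓ²(μ, ℂ) →L[ℂ] ℓ²(ι, ℂ)) :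
    hsSq (A ∘L B) ≤ ENNReal.ofReal (‖B‖ ^ 2) * hsSq A := by
  rw [← hsSq_adjoint, ContinuousLinearMap.adjoint_comp, ← hsSq_adjoint A]
  refine (hsSq_comp_le _ _).trans ?_
  rw [LinearIsometryEquiv.norm_map]

omit [CompleteSpace H] in
lemma nonneg_iff {T : H →L[ℂ] H} : 0 ≤ T ↔ ∀ x, 0 ≤ inner ℂ x (T x) := by
  rw [ContinuousLinearMap.nonneg_iff_isPositive]
  refine ⟨fun h x => h.inner_nonneg_right x, fun h => ?_⟩
  rw [ContinuousLinearMap.isPositive_iff_complex]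
  intro x
  have h1 := h x
  rw [Complex.nonneg_iff] at h1
  have e : inner ℂ (T x) x = inner ℂ x (T x) := by
    rw [← inner_conj_symm]
    exact Complex.conj_eq_iff_im.2 h1.2.symm
  rw [e]
  exact ⟨Complex.ext rfl h1.2, h1.1⟩

lemma re_inner_mono {S T : H →L[ℂ] H} (h : S ≤ T) (x : H) :
    (inner ℂ x (S x)).re ≤ (inner ℂ x (T x)).re := by
  have := (Complex.nonneg_iff.1 (nonneg_iff.1 (sub_nonneg.2 h) x)).1
  simpa [inner_sub_right] using this

lemma inner_adjoint_comp_self {H' : Type*} [NormedAddCommGroup H'] [InnerProductSpace ℂ H']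
    [CompleteSpace H'] (S : H →L[ℂ] H') (x : H) :
    (inner ℂ x ((S.adjoint ∘L S) x)).re = ‖S x‖ ^ 2 := by
  rw [ContinuousLinearMap.comp_apply, ContinuousLinearMap.adjoint_inner_right,
    inner_self_eq_norm_sq_to_K]
  norm_cast

/-- A regularised polar decomposition. -/
lemma exists_polar_approx (T : H →L[ℂ] H) {ε : ℝ} (hε : 0 < ε) :
    ∃ V Q K : H →L[ℂ] H, T = V * Q ∧ star V * V ≤ absOp T ∧
      star Q * Q = absOp T + (ε : ℂ) • 1 ∧ ‖K‖ ≤ 1 ∧ 0 ≤ K * T ∧ absOp T - (ε : ℂ) • 1 ≤ K * T := by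
  set A := absOp T with hA
  have hA0 : 0 ≤ A := CFC.abs_nonneg T
  have hAA : A * A = star T * T := CFC.abs_mul_abs T
  have hsa : IsSelfAdjoint A := .of_nonneg hA0
  have hsp : ∀ x ∈ spectrum ℝ A, 0 ≤ x := fun x hx => spectrum_nonneg_of_nonneg hA0 hx
  have hpos : ∀ x : ℝ, 0 < |x| + ε := fun x => by positivity
  -- With A = |T|, the choice is Q = (A+ε)^{1/2}, V = T(A+ε)^{-1/2} and K = (A+ε)^{-1}T†. The shift
  -- by ε replaces the partial isometry of the exact decomposition by continuous functions of A; |x|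
  -- agrees with x on the spectrum and keeps them continuous on all of ℝ. Then V†V = KT = A²/(A+ε)
  -- lies between A-ε and A, and KK† = A²/(A+ε)² ≤ 1.
  set q : ℝ → ℝ := fun x => √(|x| + ε)
  set g : ℝ → ℝ := fun x => (√(|x| + ε))⁻¹
  have hq : Continuous q := by fun_prop
  have hg : Continuous g := hq.inv₀ fun x => (Real.sqrt_pos.2 (hpos x)).ne'
  have hid : cfc (fun x : ℝ => x) A = A := cfc_id' ℝ A
  have hgs : star (cfc g A) = cfc g A := (cfc_predicate g A : IsSelfAdjoint _)
  have hqs : star (cfc q A) = cfc q A := (cfc_predicate q A : IsSelfAdjoint _)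
  have hxx : cfc (fun x : ℝ => x * x) A = A * A := by
    rw [cfc_mul (fun x : ℝ => x) (fun x => x) A, hid]
  have hggv : ∀ x, 0 ≤ x → g x * g x = (x + ε)⁻¹ := fun x hx => by
    simp only [g, abs_of_nonneg hx]
    rw [← mul_inv, Real.mul_self_sqrt (by positivity)]
  refine ⟨T * cfc g A, cfc q A, cfc (fun x => g x * g x) A * star T, ?_, ?_, ?_, ?_, ?_, ?_⟩
  · rw [mul_assoc, ← cfc_mul _ _ A hg.continuousOn hq.continuousOn]
    have : (fun x => g x * q x) = fun _ => 1 := by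
      ext x
      exact inv_mul_cancel₀ (Real.sqrt_pos.2 (hpos x)).ne'
    rw [this, cfc_const_one ℝ A, mul_one]
  · rw [star_mul, hgs, show cfc g A * star T * (T * cfc g A) = cfc g A * (star T * T) * cfc g A by
      simp only [mul_assoc], ← hAA, ← hxx,
      ← cfc_mul _ _ A hg.continuousOn (by fun_prop), ← cfc_mul _ _ A (by fun_prop) hg.continuousOn]
    nth_rw 2 [← hid]
    refine cfc_mono (fun x hx => ?_) (by fun_prop) (by fun_prop)
    have hx := hsp x hx
    rw [show g x * (x * x) * g x = g x * g x * (x * x) by ring, hggv x hx,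
      inv_mul_le_iff₀ (by positivity)]
    nlinarith
  · rw [hqs, ← cfc_mul _ _ A hq.continuousOn hq.continuousOn]
    nth_rw 2 [← hid]
    have h1 : (ε : ℂ) • (1 : H →L[ℂ] H) = cfc (fun _ : ℝ => ε) A := by
      rw [cfc_const ε A, Algebra.algebraMap_eq_smul_one]; rfl
    rw [h1, ← cfc_add (R := ℝ) A (fun x => x) (fun _ => ε)]
    refine cfc_congr fun x hx => ?_
    simp only [q]
    rw [Real.mul_self_sqrt (hpos x).le, abs_of_nonneg (hsp x hx)]
  · set K := cfc (fun x => g x * g x) A * star T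
    have hgc : ContinuousOn (fun x => g x * g x) (spectrum ℝ A) := by fun_prop
    have hK : K * star K ≤ 1 := by
      have hs : star (cfc (fun x => g x * g x) A) = cfc (fun x => g x * g x) A :=
        (cfc_predicate _ A : IsSelfAdjoint _)
      simp only [K]
      rw [star_mul, star_star, hs, mul_assoc, ← mul_assoc (star T), ← hAA, ← hxx,
        ← cfc_mul _ _ A (by fun_prop) hgc, ← cfc_mul _ _ A hgc (by fun_prop)]
      refine cfc_le_one _ _ fun x hx => ?_
      have hx := hsp x hx
      rw [hggv x hx]
      have : 0 < x + ε := by positivity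
      rw [inv_mul_le_iff₀ this, mul_inv_le_iff₀ this]
      nlinarith
    have h2 : ‖K * star K‖ ≤ 1 := by
      rw [CStarAlgebra.norm_le_one_iff_of_nonneg _ (mul_star_self_nonneg K)]
      exact hK
    rw [CStarRing.norm_self_mul_star] at h2
    nlinarith [norm_nonneg K]
  · rw [mul_assoc, ← hAA, ← hxx, ← cfc_mul _ _ A (by fun_prop) (by fun_prop)]
    exact cfc_nonneg fun x _ => mul_nonneg (mul_self_nonneg _) (mul_self_nonneg _)
  · rw [mul_assoc, ← hAA, ← hxx, ← cfc_mul _ _ A (by fun_prop) (by fun_prop)]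
    have h1 : (ε : ℂ) • (1 : H →L[ℂ] H) = cfc (fun _ : ℝ => ε) A := by
      rw [cfc_const ε A, Algebra.algebraMap_eq_smul_one]; rfl
    nth_rw 1 [← hid]
    rw [h1, ← cfc_sub (fun x => x) (fun _ => ε) A]
    refine cfc_mono (fun x hx => ?_) (by fun_prop) (by fun_prop)
    have hx := hsp x hx
    rw [hggv x hx, inv_mul_eq_div, le_div_iff₀ (by positivity)]
    nlinarith [sq_nonneg ε]

lemma exists_nonneg_sqrt {P : H →L[ℂ] H} (hP : 0 ≤ P) :
    ∃ S : H →L[ℂ] H, 0 ≤ S ∧ S * S = P ∧ ∀ K, Commute P K → Commute S K := by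
  refine ⟨CFC.sqrt P, CFC.sqrt_nonneg P, CFC.sqrt_mul_sqrt_self P hP, fun K hK => ?_⟩
  rw [CFC.sqrt]
  exact hK.cfcₙ_nnreal _

lemma mul_nonneg_of_commute {P Q : H →L[ℂ] H} (hP : 0 ≤ P) (hQ : 0 ≤ Q) (h : Commute P Q) :
    0 ≤ P * Q := h.mul_nonneg hP hQ

lemma absOp_nonneg (T : H →L[ℂ] H) : 0 ≤ absOp T := CFC.abs_nonneg T

lemma absOp_of_nonneg {T : H →L[ℂ] H} (hT : 0 ≤ T) : absOp T = T := CFC.abs_of_nonneg T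

end

/-! ### Trace norm, trace class and duality with contractions -/

section

lemma hsSq_eq_tsum (S : Op ι) :
    hsSq S = ∑' i, ENNReal.ofReal (inner ℂ (ket i) ((star S * S) (ket i))).re := by
  unfold hsSq
  congr! 3 with i
  exact (inner_adjoint_comp_self S (ket i)).symm

lemma hsSq_le_traceNorm {V T : Op ι} (h : star V * V ≤ absOp T) : hsSq V ≤ traceNorm T := by
  rw [hsSq_eq_tsum]
  exact ENNReal.tsum_le_tsum fun i => ENNReal.ofReal_le_ofReal (re_inner_mono h _)

lemma hsSq_eq_traceNorm {S T : Op ι} (h : star S * S = absOp T) : hsSq S = traceNorm T := by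
  rw [hsSq_eq_tsum, h, traceNorm]

lemma sum_norm_sq_le_of_hsSq_le (A : ℓ²(ι, ℂ) →L[ℂ] ℓ²(κ, ℂ)) {c : ℝ} (hc : 0 ≤ c)
    (h : hsSq A ≤ ENNReal.ofReal c) (F : Finset ι) : ∑ i ∈ F, ‖A (ket i)‖ ^ 2 ≤ c := by
  have h1 := (ENNReal.sum_le_tsum F).trans h
  rw [← ENNReal.ofReal_sum_of_nonneg (fun i _ => by positivity)] at h1
  exact (ENNReal.ofReal_le_ofReal_iff hc).1 h1

/-- Split T = VQ as in `exists_polar_approx` and apply Cauchy-Schwarz: the two factors are parts of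
the squared Hilbert-Schmidt norms of (AV)† and QB. The regularisation in Q†Q contributes an error
per basis vector, so the sum is kept finite and ε is chosen after `F`. -/
lemma sum_norm_inner_le {T : Op ι} (hT : IsTraceClass T) (A : ℓ²(ι, ℂ) →L[ℂ] ℓ²(κ, ℂ))
    (B : ℓ²(κ, ℂ) →L[ℂ] ℓ²(ι, ℂ)) (F : Finset κ) :
    ∑ i ∈ F, ‖inner ℂ (ket i) (A (T (B (ket i))))‖ ≤ ‖A‖ * ‖B‖ * (traceNorm T).toReal := by
  set τ := (traceNorm T).toReal
  have hτ0 : 0 ≤ τ := ENNReal.toReal_nonneg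
  have hτ : traceNorm T = ENNReal.ofReal τ := (ENNReal.ofReal_toReal hT).symm
  refine abs_le_of_sq_le_sq' ?_ (by positivity) |>.2
  refine le_of_forall_pos_le_add fun δ hδ => ?_
  -- c is the coefficient of the regularisation parameter in the final product, so the parameter
  -- δ/(c+1) costs less than δ.
  obtain ⟨c, hc0, hc⟩ : ∃ c : ℝ, 0 ≤ c ∧ ‖A‖ ^ 2 * τ * (F.card * ‖B‖ ^ 2) = c :=
    ⟨_, mul_nonneg (by positivity) (mul_nonneg (Nat.cast_nonneg _) (sq_nonneg _)), rfl⟩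
  have hc1 : 0 < c + 1 := by linarith
  obtain ⟨V, Q, -, hVQ, hV, hQ, -⟩ := exists_polar_approx T (div_pos hδ hc1)
  obtain ⟨S, hS0, hSS, -⟩ := exists_nonneg_sqrt (absOp_nonneg T)
  have hs : star S * S = absOp T := by rw [(IsSelfAdjoint.of_nonneg hS0).star_eq, hSS]
  have h1 : ∑ i ∈ F, ‖(V.adjoint ∘L A.adjoint) (ket i)‖ ^ 2 ≤ ‖A‖ ^ 2 * τ := by
    refine sum_norm_sq_le_of_hsSq_le _ (by positivity) ?_ F
    rw [← ContinuousLinearMap.adjoint_comp, hsSq_adjoint, ENNReal.ofReal_mul (by positivity), ← hτ]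
    exact (hsSq_comp_le _ _).trans (by gcongr; exact hsSq_le_traceNorm hV)
  have h2 : ∑ i ∈ F, ‖(S ∘L B) (ket i)‖ ^ 2 ≤ ‖B‖ ^ 2 * τ := by
    refine sum_norm_sq_le_of_hsSq_le _ (by positivity) ?_ F
    rw [ENNReal.ofReal_mul (by positivity), ← hτ, ← hsSq_eq_traceNorm hs]
    exact hsSq_comp_le' _ _
  have h3 : ∀ i, ‖Q (B (ket i))‖ ^ 2 ≤
      ‖(S ∘L B) (ket i)‖ ^ 2 + δ / (c + 1) * ‖B‖ ^ 2 := by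
    intro i
    have e1 : ‖Q (B (ket i))‖ ^ 2 = (inner ℂ (B (ket i)) ((star Q * Q) (B (ket i)))).re :=
      (inner_adjoint_comp_self Q _).symm
    have e2 : ‖S (B (ket i))‖ ^ 2 = _ :=
      (inner_adjoint_comp_self S (B (ket i))).symm
    have hs' : S.adjoint ∘L S = absOp T := hs
    rw [hs'] at e2
    rw [e1, hQ, ContinuousLinearMap.comp_apply, e2, add_apply, inner_add_right,
      Complex.add_re]
    gcongr
    rw [smul_apply, one_apply_eq_self, inner_smul_right,
      inner_self_eq_norm_sq_to_K]
    have : ‖B (ket i)‖ ≤ ‖B‖ := by simpa [norm_ket] using B.le_opNorm (ket i)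
    have e3 : ((((δ / (c + 1) : ℝ) : ℂ)) * ((‖B (ket i)‖ : ℝ) : ℂ) ^ 2).re =
        δ / (c + 1) * ‖B (ket i)‖ ^ 2 := by norm_cast
    exact e3.le.trans (by gcongr)
  have h4 : ∑ i ∈ F, ‖Q (B (ket i))‖ ^ 2 ≤ ‖B‖ ^ 2 * τ + δ / (c + 1) * (F.card * ‖B‖ ^ 2) := by
    refine (Finset.sum_le_sum fun i _ => h3 i).trans ?_
    rw [Finset.sum_add_distrib, Finset.sum_const, nsmul_eq_mul]
    linarith
  calc (∑ i ∈ F, ‖inner ℂ (ket i) (A (T (B (ket i))))‖) ^ 2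
      ≤ (∑ i ∈ F, ‖(V.adjoint ∘L A.adjoint) (ket i)‖ * ‖Q (B (ket i))‖) ^ 2 := by
        gcongr with i
        rw [hVQ, ← ContinuousLinearMap.adjoint_inner_left, mul_apply_eq_comp,
          ← ContinuousLinearMap.adjoint_inner_left]
        exact norm_inner_le_norm _ _
    _ ≤ (∑ i ∈ F, ‖(V.adjoint ∘L A.adjoint) (ket i)‖ ^ 2) * ∑ i ∈ F, ‖Q (B (ket i))‖ ^ 2 :=
        Finset.sum_mul_sq_le_sq_mul_sq _ _ _
    _ ≤ (‖A‖ ^ 2 * τ) * (‖B‖ ^ 2 * τ + δ / (c + 1) * (F.card * ‖B‖ ^ 2)) := by gcongr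
    _ = (‖A‖ * ‖B‖ * τ) ^ 2 + δ * (c / (c + 1)) := by rw [← hc]; ring
    _ ≤ (‖A‖ * ‖B‖ * τ) ^ 2 + δ := by
        have : c / (c + 1) ≤ 1 := (div_le_one hc1).2 (by linarith)
        nlinarith

/-- The approximate polar contraction satisfies KT ≥ |T| - ε, so it nearly attains any partial sum
of the trace norm. Only K with KT ≥ 0 need testing; for these, partial sums are bounded by the full
trace. -/
lemma traceNorm_le_of_sum_le {T : Op ι} {c : ℝ}
    (h : ∀ K : Op ι, ‖K‖ ≤ 1 → 0 ≤ K * T → ∀ F : Finset ι,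
      ∑ i ∈ F, (inner ℂ (ket i) (K (T (ket i)))).re ≤ c) :
    traceNorm T ≤ ENNReal.ofReal c := by
  have hc : 0 ≤ c := by simpa using h 0 (by simp) (by simp) ∅
  unfold traceNorm
  rw [ENNReal.tsum_eq_iSup_sum]
  refine iSup_le fun F => ?_
  have h0 : ∀ i, 0 ≤ (inner ℂ (ket i) (absOp T (ket i))).re := fun i =>
    (Complex.nonneg_iff.1 (nonneg_iff.1 (absOp_nonneg T) (ket i))).1
  rw [← ENNReal.ofReal_sum_of_nonneg fun i _ => h0 i]
  refine ENNReal.ofReal_le_ofReal (le_of_forall_pos_le_add fun δ hδ => ?_)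
  obtain ⟨-, -, K, -, -, -, hK, hK0, hKT⟩ :=
    exists_polar_approx T (ε := δ / (F.card + 1)) (by positivity)
  have h1 : ∀ i, (inner ℂ (ket i) (absOp T (ket i))).re ≤
      (inner ℂ (ket i) (K (T (ket i)))).re + δ / (F.card + 1) := by
    intro i
    have := re_inner_mono hKT (ket i)
    rw [sub_apply, inner_sub_right, smul_apply,
      one_apply_eq_self, inner_smul_right, inner_self_eq_norm_sq_to_K, norm_ket] at this
    simp only [Complex.sub_re, RCLike.ofReal_one, one_pow, mul_one, Complex.ofReal_re] at this
    rw [mul_apply_eq_comp] at this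
    linarith
  refine (Finset.sum_le_sum fun i _ => h1 i).trans ?_
  rw [Finset.sum_add_distrib, Finset.sum_const, nsmul_eq_mul]
  have h2 : (F.card : ℝ) * (δ / (F.card + 1)) ≤ δ := by
    rw [← mul_div_assoc, div_le_iff₀ (by positivity)]
    nlinarith
  linarith [h K hK hK0 F]

lemma sum_re_inner_le {T : Op ι} (hT : IsTraceClass T) (A : ℓ²(ι, ℂ) →L[ℂ] ℓ²(κ, ℂ))
    (B : ℓ²(κ, ℂ) →L[ℂ] ℓ²(ι, ℂ)) (F : Finset κ) :
    ∑ i ∈ F, (inner ℂ (ket i) (A (T (B (ket i))))).re ≤ ‖A‖ * ‖B‖ * (traceNorm T).toReal :=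
  (Finset.sum_le_sum fun _ _ => Complex.re_le_norm _).trans (sum_norm_inner_le hT A B F)

lemma norm_one_le : ‖(1 : Op ι)‖ ≤ 1 := ContinuousLinearMap.norm_id_le

lemma traceNorm_zero : traceNorm (0 : Op ι) = 0 := by
  simp [traceNorm, absOp]

/-- By duality the trace norm is bounded through functionals linear in the operator, so the triangle
inequality passes through the pairing with a single K. -/
lemma traceNorm_add_le (S T : Op ι) : traceNorm (S + T) ≤ traceNorm S + traceNorm T := by
  by_cases hS : traceNorm S = ∞
  · simp [hS]
  by_cases hT : traceNorm T = ∞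
  · simp [hT]
  rw [← ENNReal.ofReal_toReal hS, ← ENNReal.ofReal_toReal hT,
    ← ENNReal.ofReal_add ENNReal.toReal_nonneg ENNReal.toReal_nonneg]
  refine traceNorm_le_of_sum_le fun K hK _ F => ?_
  simp only [add_apply, map_add, inner_add_right, Complex.add_re,
    Finset.sum_add_distrib]
  have key : ∀ {X : Op ι}, traceNorm X ≠ ∞ →
      ∑ i ∈ F, (inner ℂ (ket i) (K (X (ket i)))).re ≤ (traceNorm X).toReal := fun {X} hX => by
    refine (sum_re_inner_le hX K 1 F).trans ?_
    have := mul_le_one₀ hK (norm_nonneg _) (norm_one_le (ι := ι))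
    have h0 : 0 ≤ (traceNorm X).toReal := ENNReal.toReal_nonneg
    nlinarith
  exact add_le_add (key hS) (key hT)

lemma traceNorm_comp_le (T : Op ι) (A : ℓ²(ι, ℂ) →L[ℂ] ℓ²(κ, ℂ)) (B : ℓ²(κ, ℂ) →L[ℂ] ℓ²(ι, ℂ))
    (hT : IsTraceClass T) :
    traceNorm (A ∘L T ∘L B) ≤ ENNReal.ofReal (‖A‖ * ‖B‖) * traceNorm T := by
  conv_rhs => rw [← ENNReal.ofReal_toReal hT]
  rw [← ENNReal.ofReal_mul (by positivity)]
  refine traceNorm_le_of_sum_le fun K hK _ F => ?_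
  refine (sum_re_inner_le hT (K ∘L A) B F).trans ?_
  gcongr
  refine (ContinuousLinearMap.opNorm_comp_le _ _).trans ?_
  nlinarith [norm_nonneg A]

lemma IsTraceClass.comp {T : Op ι} (hT : IsTraceClass T) (A : ℓ²(ι, ℂ) →L[ℂ] ℓ²(κ, ℂ))
    (B : ℓ²(κ, ℂ) →L[ℂ] ℓ²(ι, ℂ)) : IsTraceClass (A ∘L T ∘L B) :=
  ne_top_of_le_ne_top (ENNReal.mul_ne_top ENNReal.ofReal_ne_top hT) (traceNorm_comp_le T A B hT)

lemma IsTraceClass.mul_left {T : Op ι} (hT : IsTraceClass T) (K : Op ι) : IsTraceClass (K * T) :=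
  hT.comp K 1

lemma IsTraceClass.mul_right {T : Op ι} (hT : IsTraceClass T) (K : Op ι) : IsTraceClass (T * K) :=
  hT.comp 1 K

lemma IsTraceClass.add {S T : Op ι} (hS : IsTraceClass S) (hT : IsTraceClass T) :
    IsTraceClass (S + T) :=
  ne_top_of_le_ne_top (ENNReal.add_ne_top.2 ⟨hS, hT⟩) (traceNorm_add_le S T)

lemma IsTraceClass.smul {T : Op ι} (hT : IsTraceClass T) (c : ℂ) : IsTraceClass (c • T) := by
  have := hT.mul_left (c • 1)
  rwa [smul_mul_assoc, one_mul] at this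

lemma isTraceClass_zero : IsTraceClass (0 : Op ι) := by simp [IsTraceClass, traceNorm_zero]

lemma IsTraceClass.sum {m : Type*} (s : Finset m) {T : m → Op ι}
    (hT : ∀ a ∈ s, IsTraceClass (T a)) : IsTraceClass (∑ a ∈ s, T a) := by
  classical
  induction s using Finset.induction_on with
  | empty => simpa using isTraceClass_zero
  | insert a s ha ih =>
    rw [Finset.sum_insert ha]
    exact (hT a (by simp)).add (ih fun b hb => hT b (by simp [hb]))

lemma IsTraceClass.sub {S T : Op ι} (hS : IsTraceClass S) (hT : IsTraceClass T) :
    IsTraceClass (S - T) := by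
  have := hS.add (hT.smul (-1))
  rwa [neg_one_smul, ← sub_eq_add_neg] at this

lemma traceNorm_sum_le {m : Type*} (s : Finset m) (T : m → Op ι) :
    traceNorm (∑ a ∈ s, T a) ≤ ∑ a ∈ s, traceNorm (T a) := by
  classical
  induction s using Finset.induction_on with
  | empty => simp [traceNorm_zero]
  | insert a s ha ih =>
    rw [Finset.sum_insert ha, Finset.sum_insert ha]
    exact (traceNorm_add_le _ _).trans (by gcongr)

lemma IsTraceClass.summable {T : Op ι} (hT : IsTraceClass T) :
    Summable fun i => inner ℂ (ket i) (T (ket i)) := by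
  refine Summable.of_norm (summable_of_sum_le (fun _ => norm_nonneg _)
    fun F => sum_norm_inner_le hT 1 1 F)

lemma IsTraceClass.hasSum {T : Op ι} (hT : IsTraceClass T) :
    HasSum (fun i => inner ℂ (ket i) (T (ket i))) (trace T) := hT.summable.hasSum

lemma trace_add {S T : Op ι} (hS : IsTraceClass S) (hT : IsTraceClass T) :
    trace (S + T) = trace S + trace T := by
  refine HasSum.tsum_eq ?_
  simpa [inner_add_right] using hS.hasSum.add hT.hasSum

lemma trace_smul (c : ℂ) (T : Op ι) : trace (c • T) = c * trace T := by
  simp only [trace, smul_apply, inner_smul_right, tsum_mul_left]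

lemma trace_sub {S T : Op ι} (hS : IsTraceClass S) (hT : IsTraceClass T) :
    trace (S - T) = trace S - trace T := by
  refine HasSum.tsum_eq ?_
  simpa [inner_sub_right] using hS.hasSum.sub hT.hasSum

lemma trace_sum {m : Type*} (s : Finset m) {T : m → Op ι} (hT : ∀ a ∈ s, IsTraceClass (T a)) :
    trace (∑ a ∈ s, T a) = ∑ a ∈ s, trace (T a) := by
  refine HasSum.tsum_eq ?_
  simpa [inner_sum] using hasSum_sum fun a ha => (hT a ha).hasSum

/-- The trace norm is attained by pairing with contractions. -/
lemma traceNorm_le_of_norm_trace_le {T : Op ι} (hT : IsTraceClass T) {c : ℝ}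
    (h : ∀ K : Op ι, ‖K‖ ≤ 1 → ‖trace (K * T)‖ ≤ c) : traceNorm T ≤ ENNReal.ofReal c := by
  refine traceNorm_le_of_sum_le fun K hK hKT F => ?_
  have hs := (hT.mul_left K).hasSum
  refine (sum_le_hasSum F (fun i _ => ?_) (Complex.hasSum_re hs)).trans
    ((Complex.re_le_norm _).trans (h K hK))
  exact (Complex.nonneg_iff.1 (nonneg_iff.1 hKT (ket i))).1

end

/-! ### Cyclicity of the trace, local operators and partial traces -/

section

variable {γ : Type*}

lemma summable_of_hsSq_ne_top {A : ℓ²(ι, ℂ) →L[ℂ] ℓ²(κ, ℂ)} (hA : hsSq A ≠ ∞) :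
    Summable fun p : ι × κ => ‖A (ket p.1) p.2‖ ^ 2 := by
  have h : ∑' p : ι × κ, ENNReal.ofReal (‖A (ket p.1) p.2‖ ^ 2) ≠ ∞ := by
    rw [ENNReal.tsum_prod']
    simp_rw [← ofReal_norm_sq]
    exact hA
  have := ENNReal.summable_toReal h
  simpa [ENNReal.toReal_ofReal] using this

/-- The trace is cyclic on Hilbert-Schmidt operators. -/
lemma trace_star_mul_comm {A B : Op ι} (hA : hsSq A ≠ ∞) (hB : hsSq B ≠ ∞) :
    trace (star A * B) = trace (B * star A) := by
  let f : ι → ι → ℂ := fun i m => inner ℂ (A (ket i) m) (B (ket i) m)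
  have hs : Summable fun p : ι × ι => f p.1 p.2 := by
    refine Summable.of_norm_bounded
      ((summable_of_hsSq_ne_top hA).add (summable_of_hsSq_ne_top hB)) fun p => ?_
    refine (norm_inner_le_norm _ _).trans ?_
    nlinarith only [sq_nonneg (‖A (ket p.1) p.2‖ - ‖B (ket p.1) p.2‖),
      sq_nonneg (‖A (ket p.1) p.2‖), sq_nonneg (‖B (ket p.1) p.2‖)]
  have h1 : trace (star A * B) = ∑' i, ∑' m, f i m := by
    refine tsum_congr fun i => ?_
    rw [mul_apply_eq_comp, ContinuousLinearMap.star_eq_adjoint,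
      ContinuousLinearMap.adjoint_inner_right, lp.inner_eq_tsum]
  have h2 : trace (B * star A) = ∑' m, ∑' i, f i m := by
    refine tsum_congr fun m => ?_
    rw [mul_apply_eq_comp, ← ContinuousLinearMap.adjoint_inner_left, lp.inner_eq_tsum]
    refine tsum_congr fun i => ?_
    have e1 : B.adjoint (ket m) i = star (B (ket i) m) := by
      rw [← inner_ket_left, ContinuousLinearMap.adjoint_inner_right, ← inner_conj_symm,
        inner_ket_left]
      rfl
    have e2 : star A (ket m) i = star (A (ket i) m) := by
      rw [ContinuousLinearMap.star_eq_adjoint, ← inner_ket_left,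
        ContinuousLinearMap.adjoint_inner_right, ← inner_conj_symm, inner_ket_left]
      rfl
    rw [e1, e2]
    simp [f, mul_comm]
  rw [h1, h2]
  exact (Summable.tsum_comm (f := f) hs).symm

/-- T = S² with S Hilbert-Schmidt, and one S accompanies each factor, so cyclicity for
Hilbert-Schmidt pairs applies twice. -/
lemma trace_mul_mul_comm {T : Op ι} (hT0 : 0 ≤ T) (hT : IsTraceClass T) (X R : Op ι) :
    trace (X * T * R) = trace (R * X * T) := by
  obtain ⟨S, hS0, hSS, -⟩ := exists_nonneg_sqrt hT0
  have hSs : star S = S := (IsSelfAdjoint.of_nonneg hS0).star_eq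
  have hS : hsSq S ≠ ∞ := by
    rw [hsSq_eq_traceNorm (S := S) (T := T) (by rw [hSs, hSS, absOp_of_nonneg hT0])]
    exact hT
  have hl : ∀ Y : Op ι, hsSq (Y * S) ≠ ∞ := fun Y =>
    ne_top_of_le_ne_top (ENNReal.mul_ne_top ENNReal.ofReal_ne_top hS) (hsSq_comp_le Y S)
  have hr : ∀ Y : Op ι, hsSq (S * Y) ≠ ∞ := fun Y =>
    ne_top_of_le_ne_top (ENNReal.mul_ne_top ENNReal.ofReal_ne_top hS) (hsSq_comp_le' S Y)
  have h1 := trace_star_mul_comm (hr (star X)) (hr R)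
  have h2 := trace_star_mul_comm hS (hl (R * X))
  rw [star_mul, star_star, hSs] at h1
  rw [hSs] at h2
  rw [← hSS]
  calc trace (X * (S * S) * R) = trace (X * S * (S * R)) := by simp only [mul_assoc]
    _ = trace (S * (R * X * S)) := by rw [h1]; simp only [mul_assoc]
    _ = trace (R * X * (S * S)) := by rw [h2]; simp only [mul_assoc]

lemma trace_nonneg {P : Op ι} (hP : 0 ≤ P) : 0 ≤ trace P :=
  tsum_nonneg fun i => nonneg_iff.1 hP (ket i)

lemma mul_mul_self_nonneg {P R : Op ι} (hP : 0 ≤ P) (hR : 0 ≤ R) : 0 ≤ R * P * R := by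
  rw [nonneg_iff] at hP ⊢
  intro x
  have h : inner ℂ x ((R * P * R) x) = inner ℂ (R x) (P (R x)) := by
    rw [mul_apply_eq_comp, mul_apply_eq_comp, ← ContinuousLinearMap.adjoint_inner_left,
      ← ContinuousLinearMap.star_eq_adjoint, (IsSelfAdjoint.of_nonneg hR).star_eq]
  rw [h]
  exact hP _

lemma trace_mul_nonneg {N T : Op ι} (hN : 0 ≤ N) (hT0 : 0 ≤ T) (hT : IsTraceClass T) :
    0 ≤ trace (N * T) := by
  obtain ⟨R, hR0, hRR, -⟩ := exists_nonneg_sqrt hN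
  rw [← hRR, ← trace_mul_mul_comm hT0 hT R R]
  exact trace_nonneg (mul_mul_self_nonneg hT0 hR0)

lemma traceNorm_of_nonneg {P : Op ι} (hP : 0 ≤ P) :
    traceNorm P = ∑' i, ENNReal.ofReal (inner ℂ (ket i) (P (ket i))).re := by
  rw [traceNorm, absOp_of_nonneg hP]

/-- The operator norm of P^{1/2} is at most its Hilbert-Schmidt norm, whose square is tr P. This
turns summability of trace norms into operator-norm summability of the partial trace series. -/
lemma norm_le_traceNorm_of_nonneg {P : Op ι} (hP : 0 ≤ P) :
    ENNReal.ofReal ‖P‖ ≤ traceNorm P := by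
  obtain ⟨S, hS0, hSS, -⟩ := exists_nonneg_sqrt hP
  have hSs : star S = S := (IsSelfAdjoint.of_nonneg hS0).star_eq
  rw [← hsSq_eq_traceNorm (S := S) (T := P) (by rw [hSs, hSS, absOp_of_nonneg hP])]
  by_cases hS : hsSq S = ∞
  · simp [hS]
  rw [← ENNReal.ofReal_toReal hS]
  refine ENNReal.ofReal_le_ofReal ?_
  set h := (hsSq S).toReal
  have hh : 0 ≤ h := ENNReal.toReal_nonneg
  have hb : ‖S‖ ≤ √h := by
    refine S.opNorm_le_bound (Real.sqrt_nonneg _) fun x => ?_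
    have : ENNReal.ofReal (‖S x‖ ^ 2) ≤ ENNReal.ofReal (h * ‖x‖ ^ 2) := by
      rw [ofReal_norm_sq, mul_comm, ENNReal.ofReal_mul (by positivity), ENNReal.ofReal_toReal hS,
        hsSq, ← ENNReal.tsum_mul_left]
      refine ENNReal.tsum_le_tsum fun i => ?_
      rw [← ENNReal.ofReal_mul (by positivity), ← mul_pow]
      refine ENNReal.ofReal_le_ofReal ?_
      gcongr
      rw [← inner_ket_left, ← ContinuousLinearMap.adjoint_inner_left,
        ← ContinuousLinearMap.star_eq_adjoint, hSs, mul_comm]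
      exact norm_inner_le_norm _ _
    rw [ENNReal.ofReal_le_ofReal_iff (by positivity)] at this
    refine abs_le_of_sq_le_sq' ?_ (by positivity) |>.2
    rwa [mul_pow, Real.sq_sqrt hh]
  calc ‖P‖ ≤ ‖S‖ * ‖S‖ := hSS ▸ norm_mul_le S S
    _ ≤ √h * √h := by gcongr
    _ = h := Real.mul_self_sqrt hh

section Slice

variable (e : κ ≃ ι × γ)

/-- For a factorisation `κ ≃ ι × γ` of labels, the map `1 ⊗ ⟨c|`. -/
def slice (c : γ) : ℓ²(κ, ℂ) →L[ℂ] ℓ²(ι, ℂ) :=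
  restrict (fun b => e.symm (b, c)) fun _ _ h => congrArg Prod.fst (e.symm.injective h)

lemma slice_apply (c : γ) (x : ℓ²(κ, ℂ)) (b : ι) : slice e c x b = x (e.symm (b, c)) := rfl

lemma slice_ext {x y : ℓ²(κ, ℂ)} (h : ∀ c, slice e c x = slice e c y) : x = y := by
  ext k
  have := congrArg (fun z : ℓ²(ι, ℂ) => z (e k).1) (h (e k).2)
  simpa [slice_apply] using this

lemma hasSum_inner_slice (x y : ℓ²(κ, ℂ)) :
    HasSum (fun c => inner ℂ (slice e c x) (slice e c y)) (inner ℂ x y) := by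
  have h1 := lp.hasSum_inner (𝕜 := ℂ) x y
  have h2 := ((Equiv.prodComm γ ι).trans e.symm).hasSum_iff.2 h1
  exact h2.prod_fiberwise fun c => lp.hasSum_inner (𝕜 := ℂ) (slice e c x) (slice e c y)

lemma hasSum_norm_sq_slice (x : ℓ²(κ, ℂ)) :
    HasSum (fun c => ‖slice e c x‖ ^ 2) (‖x‖ ^ 2) := by
  have h := Complex.hasSum_re (hasSum_inner_slice e x x)
  simp_rw [inner_self_eq_norm_sq_to_K] at h
  exact_mod_cast h

lemma slice_adjoint_ket (c : γ) (b : ι) : (slice e c).adjoint (ket b) = ket (e.symm (b, c)) := by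
  classical
  ext k
  rw [← inner_ket_left, ContinuousLinearMap.adjoint_inner_right, ← inner_conj_symm, inner_ket_left,
    slice_apply, ket_apply, ket_apply]
  simp [eq_comm, apply_ite]

lemma memlp_lift (K : Op ι) (x : ℓ²(κ, ℂ)) :
    Memℓp (fun k => K (slice e (e k).2 x) (e k).1) 2 := by
  refine memℓp_gen ?_
  have h : Summable fun p : γ × ι => ‖K (slice e p.1 x) p.2‖ ^ 2 := by
    refine (summable_prod_of_nonneg fun _ => by positivity).2 ⟨fun c => ?_, ?_⟩
    · exact (hasSum_norm_sq (K (slice e c x))).summable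
    · have h1 : ∀ c, ∑' b, ‖K (slice e c x) b‖ ^ 2 = ‖K (slice e c x)‖ ^ 2 := fun c =>
        (hasSum_norm_sq (K (slice e c x))).tsum_eq
      simp_rw [h1]
      refine Summable.of_nonneg_of_le (fun _ => by positivity) (fun c => ?_)
        ((hasSum_norm_sq_slice e x).summable.mul_left (‖K‖ ^ 2))
      rw [← mul_pow]
      gcongr
      exact K.le_opNorm _
  have h' := (e.trans (Equiv.prodComm ι γ)).summable_iff.2 h
  simpa [Function.comp_def] using h'

/-- The operator `K ⊗ 1`. -/
def lift (K : Op ι) : Op κ :=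
  LinearMap.mkContinuous
    { toFun := fun x => (⟨fun k => K (slice e (e k).2 x) (e k).1, memlp_lift e K x⟩ : ℓ²(κ, ℂ))
      map_add' := fun x y => by ext k; simp only [map_add]; rfl
      map_smul' := fun c x => by ext k; simp only [map_smul]; rfl }
    ‖K‖ (by
      intro x
      refine abs_le_of_sq_le_sq' ?_ (by positivity) |>.2
      rw [mul_pow]
      refine hasSum_le (fun c => ?_) (hasSum_norm_sq_slice e _)
        ((hasSum_norm_sq_slice e x).mul_left (‖K‖ ^ 2))
      have : slice e c (⟨fun k => K (slice e (e k).2 x) (e k).1, memlp_lift e K x⟩ : ℓ²(κ, ℂ)) =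
          K (slice e c x) := by
        ext b; simp [slice_apply]
      rw [← mul_pow]
      gcongr
      exact this ▸ K.le_opNorm _)

lemma lift_apply (K : Op ι) (x : ℓ²(κ, ℂ)) (k : κ) :
    lift e K x k = K (slice e (e k).2 x) (e k).1 := rfl

lemma slice_lift (K : Op ι) (c : γ) (x : ℓ²(κ, ℂ)) :
    slice e c (lift e K x) = K (slice e c x) := by
  ext b; simp [slice_apply, lift_apply]

lemma lift_add (K L : Op ι) : lift e (K + L) = lift e K + lift e L := by
  ext1 x; exact slice_ext e fun c => by simp [slice_lift]

lemma lift_sub (K L : Op ι) : lift e (K - L) = lift e K - lift e L := by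
  ext1 x; exact slice_ext e fun c => by simp [slice_lift]

lemma lift_smul (a : ℂ) (K : Op ι) : lift e (a • K) = a • lift e K := by
  ext1 x; exact slice_ext e fun c => by simp [slice_lift]

lemma lift_one : lift e (1 : Op ι) = 1 := by
  ext1 x; exact slice_ext e fun c => by simp [slice_lift]

lemma lift_nonneg {K : Op ι} (hK : 0 ≤ K) : 0 ≤ lift e K := by
  rw [nonneg_iff] at hK ⊢
  intro x
  rw [← (hasSum_inner_slice e x _).tsum_eq]
  exact tsum_nonneg fun c => by rw [slice_lift]; exact hK _

/-- The partial trace over the second factor. -/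
def partialTrace (T : Op κ) : Op ι := ∑' c, slice e c ∘L T ∘L (slice e c).adjoint

lemma inner_slice_comp (T : Op κ) (K : Op ι) (b : ι) (c : γ) :
    inner ℂ (ket b) (K ((slice e c ∘L T ∘L (slice e c).adjoint) (ket b))) =
      inner ℂ (ket (e.symm (b, c))) ((lift e K * T) (ket (e.symm (b, c)))) := by
  rw [ContinuousLinearMap.comp_apply, ContinuousLinearMap.comp_apply, slice_adjoint_ket,
    ← slice_lift, mul_apply_eq_comp, ← slice_adjoint_ket, ContinuousLinearMap.adjoint_inner_left]

/-- The span of the positive trace-class operators. -/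
def traceClassSpan (κ : Type*) : Submodule ℂ (Op κ) :=
  Submodule.span ℂ {P | 0 ≤ P ∧ IsTraceClass P}

lemma slice_comp_nonneg {P : Op κ} (hP : 0 ≤ P) (c : γ) :
    0 ≤ slice e c ∘L P ∘L (slice e c).adjoint := by
  rw [nonneg_iff] at hP ⊢
  intro x
  rw [ContinuousLinearMap.comp_apply, ContinuousLinearMap.comp_apply,
    ← ContinuousLinearMap.adjoint_inner_left]
  exact hP _

lemma traceNorm_slice_comp {P : Op κ} (hP : 0 ≤ P) :
    ∑' c, traceNorm (slice e c ∘L P ∘L (slice e c).adjoint) = traceNorm P := by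
  simp_rw [traceNorm_of_nonneg (slice_comp_nonneg e hP _), traceNorm_of_nonneg hP]
  rw [← ENNReal.tsum_prod, ← ((Equiv.prodComm γ ι).trans e.symm).tsum_eq]
  congr with p
  have := inner_slice_comp e P 1 p.2 p.1
  rw [lift_one, one_mul, one_apply_eq_self] at this
  rw [this]
  rfl

/-- For positive operators the slices are positive and their trace norms add up to that of the
whole; linearity extends this to the span. The span suffices because it contains all values of a
positive trace-preserving map (`IsPositiveTP.mem_traceClassSpan`). -/
lemma summable_slice_comp {T : Op κ} (hT : T ∈ traceClassSpan κ) :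
    Summable fun c => slice e c ∘L T ∘L (slice e c).adjoint := by
  induction hT using Submodule.span_induction with
  | mem P hP =>
    have h := traceNorm_slice_comp e hP.1
    have h1 := ENNReal.summable_toReal (h.trans_ne hP.2)
    refine Summable.of_norm_bounded h1 fun c => ?_
    have hc : traceNorm (slice e c ∘L P ∘L (slice e c).adjoint) ≠ ∞ :=
      ne_top_of_le_ne_top (h.trans_ne hP.2) (ENNReal.le_tsum c)
    rw [← ENNReal.ofReal_le_iff_le_toReal hc]
    exact norm_le_traceNorm_of_nonneg (slice_comp_nonneg e hP.1 c)
  | zero => simp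
  | add S T _ _ hS hT => simpa using hS.add hT
  | smul a T _ hT => simpa using hT.const_smul a

lemma partialTrace_add {S T : Op κ} (hS : S ∈ traceClassSpan κ) (hT : T ∈ traceClassSpan κ) :
    partialTrace e (S + T) = partialTrace e S + partialTrace e T := by
  unfold partialTrace
  rw [← (summable_slice_comp e hS).tsum_add (summable_slice_comp e hT)]
  simp

lemma partialTrace_smul (a : ℂ) {T : Op κ} (hT : T ∈ traceClassSpan κ) :
    partialTrace e (a • T) = a • partialTrace e T := by
  unfold partialTrace
  rw [← (summable_slice_comp e hT).tsum_const_smul]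
  simp

lemma isTraceClass_of_mem {T : Op κ} (hT : T ∈ traceClassSpan κ) : IsTraceClass T := by
  induction hT using Submodule.span_induction with
  | mem P hP => exact hP.2
  | zero => exact isTraceClass_zero
  | add S T _ _ hS hT => exact hS.add hT
  | smul a T _ hT => exact hT.smul a

lemma hasSum_inner_partialTrace {T : Op κ} (hT : T ∈ traceClassSpan κ) (K : Op ι) (b : ι) :
    HasSum (fun c => inner ℂ (ket (e.symm (b, c))) ((lift e K * T) (ket (e.symm (b, c)))))
      (inner ℂ (ket b) ((K * partialTrace e T) (ket b))) := by
  have h := (summable_slice_comp e hT).hasSum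
  have h1 := h.mapL (ContinuousLinearMap.apply ℂ _ (ket b))
  have h2 := h1.mapL (innerSL ℂ (ket b) ∘L K)
  simp only [← inner_slice_comp]
  exact h2

lemma partialTrace_nonneg {P : Op κ} (hP : 0 ≤ P) : 0 ≤ partialTrace e P :=
  tsum_nonneg fun c => slice_comp_nonneg e hP c

lemma isTraceClass_partialTrace_of_nonneg {P : Op κ} (hP : 0 ≤ P) (hP' : IsTraceClass P) :
    IsTraceClass (partialTrace e P) := by
  have hm : P ∈ traceClassSpan κ := Submodule.subset_span ⟨hP, hP'⟩
  have h : traceNorm (partialTrace e P) = traceNorm P := by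
    rw [traceNorm_of_nonneg (partialTrace_nonneg e hP), traceNorm_of_nonneg hP, ← e.symm.tsum_eq,
      ENNReal.tsum_prod']
    congr with b
    have h1 := Complex.hasSum_re (hasSum_inner_partialTrace e hm 1 b)
    rw [lift_one, one_mul, one_mul] at h1
    rw [← h1.tsum_eq, ENNReal.ofReal_tsum_of_nonneg (fun c =>
      (Complex.nonneg_iff.1 (nonneg_iff.1 hP _)).1) h1.summable]
  rw [IsTraceClass, h]
  exact hP'

lemma isTraceClass_partialTrace {T : Op κ} (hT : T ∈ traceClassSpan κ) :
    IsTraceClass (partialTrace e T) := by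
  induction hT using Submodule.span_induction with
  | mem P hP => exact isTraceClass_partialTrace_of_nonneg e hP.1 hP.2
  | zero => simpa [partialTrace] using isTraceClass_zero
  | add S T hS' hT' hS hT =>
    rw [partialTrace_add e hS' hT']
    exact hS.add hT
  | smul a T hT' hT =>
    rw [partialTrace_smul e a hT']
    exact hT.smul a

/-- By `inner_slice_comp` both sides are sums of the same diagonal entries, the left one grouped by
the label of the retained factor. -/
lemma trace_mul_partialTrace {T : Op κ} (hT : T ∈ traceClassSpan κ) (K : Op ι) :
    trace (K * partialTrace e T) = trace (lift e K * T) := by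
  have h := e.symm.hasSum_iff.2 ((isTraceClass_of_mem hT).mul_left (lift e K)).hasSum
  exact (h.prod_fiberwise fun b => hasSum_inner_partialTrace e hT K b).tsum_eq

end Slice

end

/-! ### Bounding the diamond norm by the values on matrix units -/

section

open InnerProductSpace (rankOne)

variable {d k : ℕ}

/-- The matrix unit `|e_s⟩⟨e_t|`. -/
def matrixUnit (s t : ι) : Op ι := rankOne ℂ (ket s) (ket t)

lemma matrixUnit_apply (s t : ι) (x : ℓ²(ι, ℂ)) : matrixUnit s t x = x t • ket s := by
  rw [matrixUnit, InnerProductSpace.rankOne_apply, inner_ket_left]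

lemma sum_smul_ket [Fintype ι] (x : ℓ²(ι, ℂ)) : ∑ i, x i • ket i = x := by
  have h := hasSum_ket x
  exact (tsum_fintype _).symm.trans h.tsum_eq

lemma rankOne_eq_sum [Fintype ι] (x y : ℓ²(ι, ℂ)) :
    (rankOne ℂ x y : Op ι) = ∑ s, ∑ t, (x s * star (y t)) • matrixUnit s t := by
  conv_lhs => rw [← sum_smul_ket x, ← sum_smul_ket y]
  simp only [map_sum, map_smul, map_smulₛₗ, sum_apply, matrixUnit, smul_apply, Finset.smul_sum,
    smul_smul]
  rw [Finset.sum_comm]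
  simp only [mul_comm, RCLike.star_def]

lemma eq_sum_rankOne [Fintype ι] (V Q : Op ι) :
    V * Q = ∑ i, (rankOne ℂ (V (ket i)) (Q.adjoint (ket i)) : Op ι) := by
  ext1 z
  rw [mul_apply_eq_comp]
  conv_lhs => rw [← sum_smul_ket (Q z)]
  simp [sum_apply, InnerProductSpace.rankOne_apply,
    ContinuousLinearMap.adjoint_inner_left, inner_ket_left]

lemma traceNorm_ne_top_of_fintype [Fintype ι] (T : Op ι) : IsTraceClass T := by
  rw [IsTraceClass, traceNorm, tsum_fintype]
  exact ENNReal.sum_ne_top.2 fun i _ => ENNReal.ofReal_ne_top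

/-- The map `v ↦ v ⊗ r`. -/
def tensorRight (κ : Type*) (r : Fin k → ℂ) : ℓ²(κ, ℂ) →L[ℂ] ℓ²(κ × Fin k, ℂ) :=
  ∑ a, r a • (ancillaBra a).adjoint

lemma ancillaBra_comp_adjoint (a b : Fin k) (v : ℓ²(κ, ℂ)) :
    ancillaBra a ((ancillaBra b).adjoint v) = if a = b then v else 0 := by
  have h : ancillaBra a ∘L (ancillaBra b).adjoint =
      if a = b then ContinuousLinearMap.id ℂ ℓ²(κ, ℂ) else 0 := by
    classical
    refine clm_ext fun i => ?_
    have h1 : (ancillaBra b).adjoint (ket i) = ket (i, b) :=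
      slice_adjoint_ket (Equiv.refl (κ × Fin k)) b i
    rw [ContinuousLinearMap.comp_apply, h1]
    ext m
    change ket (i, b) (m, a) = _
    rw [ket_apply]
    split_ifs with h2 h3 h3 <;> simp_all [ket_apply]
  have := congrArg (fun A : Op κ => A v) h
  simp only [ContinuousLinearMap.comp_apply] at this
  rw [this]
  split_ifs <;> rfl

lemma norm_tensorRight_le (r : Fin k → ℂ) : ‖tensorRight κ r‖ ≤ √(∑ a, ‖r a‖ ^ 2) := by
  refine (tensorRight κ r).opNorm_le_bound (Real.sqrt_nonneg _) fun v => ?_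
  refine abs_le_of_sq_le_sq' ?_ (by positivity) |>.2
  have h := hasSum_norm_sq_slice (Equiv.refl (κ × Fin k)) (tensorRight κ r v)
  have h1 : ∀ a, slice (Equiv.refl (κ × Fin k)) a (tensorRight κ r v) = r a • v := by
    intro a
    change ancillaBra a (tensorRight κ r v) = r a • v
    simp [tensorRight, sum_apply, ancillaBra_comp_adjoint]
  rw [← h.tsum_eq, tsum_fintype, mul_pow, Real.sq_sqrt (by positivity), Finset.sum_mul]
  simp_rw [h1, norm_smul, mul_pow]
  rfl

lemma sum_sum_comm {A S M : Type*} [Fintype A] [Fintype S] [AddCommMonoid M]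
    (f : A → A → S → S → M) :
    ∑ a, ∑ b, ∑ s, ∑ t, f a b s t = ∑ s, ∑ t, ∑ a, ∑ b, f a b s t :=
  calc _ = ∑ a, ∑ s, ∑ b, ∑ t, f a b s t := Finset.sum_congr rfl fun _ _ => Finset.sum_comm
    _ = ∑ s, ∑ a, ∑ b, ∑ t, f a b s t := Finset.sum_comm
    _ = ∑ s, ∑ a, ∑ t, ∑ b, f a b s t :=
      Finset.sum_congr rfl fun _ _ => Finset.sum_congr rfl fun _ _ => Finset.sum_comm
    _ = _ := Finset.sum_congr rfl fun _ _ => Finset.sum_comm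

/-- With p = ∑ e_s ⊗ p_s and q = ∑ e_t ⊗ q_t, each block is Φ(|s⟩⟨t|) ⊗ |p_s⟩⟨q_t|. Written as a
two-sided product with `tensorRight`, it is ready for `traceNorm_comp_le`. -/
lemma ampliation_rankOne (Φ : Op (Fin d) →ₗ[ℂ] Op κ) (p q : ℓ²(Fin d × Fin k, ℂ)) :
    ampliation k Φ (rankOne ℂ p q) = ∑ s, ∑ t, tensorRight κ (fun a => p (s, a)) ∘L
      Φ (matrixUnit s t) ∘L (tensorRight κ (fun a => q (t, a))).adjoint := by
  have h : ∀ a b, ancillaBra a ∘L (rankOne ℂ p q : Op (Fin d × Fin k)) ∘L (ancillaBra b).adjoint =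
      ∑ s, ∑ t, (p (s, a) * star (q (t, b))) • matrixUnit s t := by
    intro a b
    refine Eq.trans ?_ (rankOne_eq_sum (ancillaBra a p) (ancillaBra b q))
    ext1 z
    simp [InnerProductSpace.rankOne_apply, ContinuousLinearMap.adjoint_inner_right]
  unfold ampliation
  simp_rw [h, map_sum, map_smul]
  ext1 v
  simp only [tensorRight, map_sum, LinearIsometryEquiv.map_smulₛₗ, sum_apply,
    ContinuousLinearMap.comp_apply, smul_apply, map_smul, ContinuousLinearMap.adjoint_adjoint,
    Finset.smul_sum, smul_smul]
  rw [sum_sum_comm]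
  refine Finset.sum_congr rfl fun s _ => Finset.sum_congr rfl fun t _ => ?_
  rw [Finset.sum_comm]
  simp only [mul_comm, RCLike.star_def]

lemma sum_sqrt_le (f : Fin d × Fin k → ℂ) {r : ℝ} (hr : 0 ≤ r)
    (h : ∑ x, ‖f x‖ ^ 2 ≤ r ^ 2) : ∑ s, √(∑ a, ‖f (s, a)‖ ^ 2) ≤ √d * r := by
  refine abs_le_of_sq_le_sq' ?_ (by positivity) |>.2
  calc (∑ s, √(∑ a, ‖f (s, a)‖ ^ 2)) ^ 2
      = (∑ s : Fin d, 1 * √(∑ a, ‖f (s, a)‖ ^ 2)) ^ 2 := by simp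
    _ ≤ (∑ s : Fin d, (1 : ℝ) ^ 2) * ∑ s, √(∑ a, ‖f (s, a)‖ ^ 2) ^ 2 :=
        Finset.sum_mul_sq_le_sq_mul_sq _ _ _
    _ = d * ∑ x, ‖f x‖ ^ 2 := by
        rw [Fintype.sum_prod_type]
        congr 1
        · simp
        · exact Finset.sum_congr rfl fun s _ => Real.sq_sqrt (by positivity)
    _ ≤ d * r ^ 2 := by gcongr
    _ = (√d * r) ^ 2 := by rw [mul_pow, Real.sq_sqrt (by positivity)]

/-- The d² blocks cost only a factor d: they are weighted by ‖p_s‖‖q_t‖, and Cauchy-Schwarz bounds ∑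
‖p_s‖ by √d ‖p‖, and likewise for q. -/
lemma traceNorm_ampliation_rankOne_le (Φ : Op (Fin d) →ₗ[ℂ] Op κ) {c : ℝ} (hc : 0 ≤ c)
    (h : ∀ s t, traceNorm (Φ (matrixUnit s t)) ≤ ENNReal.ofReal c)
    (p q : ℓ²(Fin d × Fin k, ℂ)) :
    traceNorm (ampliation k Φ (rankOne ℂ p q)) ≤ ENNReal.ofReal (d * c * (‖p‖ * ‖q‖)) := by
  set P : Fin d → ℝ := fun s => √(∑ a, ‖p (s, a)‖ ^ 2)
  set Q : Fin d → ℝ := fun s => √(∑ a, ‖q (s, a)‖ ^ 2)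
  have hP : ∀ s, 0 ≤ P s := fun s => Real.sqrt_nonneg _
  have hQ : ∀ s, 0 ≤ Q s := fun s => Real.sqrt_nonneg _
  have h1 : ∀ s t, traceNorm (tensorRight κ (fun a => p (s, a)) ∘L Φ (matrixUnit s t) ∘L
      (tensorRight κ (fun a => q (t, a))).adjoint) ≤ ENNReal.ofReal (P s * Q t * c) := by
    intro s t
    refine (traceNorm_comp_le _ _ _ (ne_top_of_le_ne_top ENNReal.ofReal_ne_top (h s t))).trans ?_
    rw [ENNReal.ofReal_mul (mul_nonneg (hP s) (hQ t))]
    refine mul_le_mul' (ENNReal.ofReal_le_ofReal ?_) (h s t)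
    rw [LinearIsometryEquiv.norm_map]
    exact mul_le_mul (norm_tensorRight_le _) (norm_tensorRight_le _) (norm_nonneg _) (hP s)
  have hsum : ∀ x : ℓ²(Fin d × Fin k, ℂ), ∑ y, ‖x y‖ ^ 2 ≤ ‖x‖ ^ 2 := fun x =>
    ((tsum_fintype _).symm.trans (hasSum_norm_sq x).tsum_eq).le
  have h2 : ∑ s, P s ≤ √d * ‖p‖ := sum_sqrt_le (fun y => p y) (norm_nonneg p) (hsum p)
  have h3 : ∑ s, Q s ≤ √d * ‖q‖ := sum_sqrt_le (fun y => q y) (norm_nonneg q) (hsum q)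
  rw [ampliation_rankOne]
  refine (traceNorm_sum_le _ _).trans ?_
  refine (Finset.sum_le_sum fun s _ => (traceNorm_sum_le _ _).trans
    (Finset.sum_le_sum fun t _ => h1 s t)).trans ?_
  have h4 : ∀ s t, 0 ≤ P s * Q t * c := fun s t => mul_nonneg (mul_nonneg (hP s) (hQ t)) hc
  simp_rw [← ENNReal.ofReal_sum_of_nonneg fun t _ => h4 _ t]
  rw [← ENNReal.ofReal_sum_of_nonneg fun s _ => Finset.sum_nonneg fun t _ => h4 s t]
  refine ENNReal.ofReal_le_ofReal ?_
  calc ∑ s, ∑ t, P s * Q t * c = (∑ s, P s) * (∑ t, Q t) * c := by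
        rw [Finset.sum_mul_sum, Finset.sum_mul]
        exact Finset.sum_congr rfl fun s _ => by rw [Finset.sum_mul]
    _ ≤ (√d * ‖p‖) * (√d * ‖q‖) * c := by
        gcongr
    _ = (√d * √d) * c * (‖p‖ * ‖q‖) := by ring
    _ = d * c * (‖p‖ * ‖q‖) := by rw [Real.mul_self_sqrt (by positivity)]

lemma ampliation_sum {m : Type*} (s : Finset m) (Φ : Op ι →ₗ[ℂ] Op κ) (X : m → Op (ι × Fin k)) :
    ampliation k Φ (∑ i ∈ s, X i) = ∑ i ∈ s, ampliation k Φ (X i) := by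
  have h : ∀ a b : Fin k, (ancillaBra a).adjoint ∘L
      Φ (ancillaBra a ∘L (∑ i ∈ s, X i) ∘L (ancillaBra b).adjoint) ∘L ancillaBra b =
      ∑ i ∈ s, (ancillaBra a).adjoint ∘L
        Φ (ancillaBra a ∘L X i ∘L (ancillaBra b).adjoint) ∘L ancillaBra b := fun a b => by
    simp only [ContinuousLinearMap.finsetSum_comp, ContinuousLinearMap.comp_finsetSum, map_sum]
  unfold ampliation
  simp_rw [h]
  exact (Finset.sum_congr rfl fun _ _ => Finset.sum_comm).trans Finset.sum_comm

/-- The factorisation X = VQ writes X as a sum of rank-one operators whose norm products add up to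
at most ‖X‖₁ + dkε. The rank-one bound is summed and ε tends to 0. -/
lemma traceNorm_ampliation_le (Φ : Op (Fin d) →ₗ[ℂ] Op κ) {c : ℝ} (hc : 0 ≤ c)
    (h : ∀ s t, traceNorm (Φ (matrixUnit s t)) ≤ ENNReal.ofReal c) (X : Op (Fin d × Fin k)) :
    traceNorm (ampliation k Φ X) ≤ ENNReal.ofReal (d * c) * traceNorm X := by
  have hX : traceNorm X ≠ ∞ := traceNorm_ne_top_of_fintype X
  have key : ∀ ε : ℝ, 0 < ε → traceNorm (ampliation k Φ X) ≤
      ENNReal.ofReal (d * c * (traceNorm X).toReal + d * c * (d * k) * ε) := by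
    intro ε hε
    obtain ⟨V, Q, -, hVQ, hV, hQ, -⟩ := exists_polar_approx X hε
    have h1 : ∑ i, ‖V (ket i)‖ ^ 2 ≤ (traceNorm X).toReal :=
      sum_norm_sq_le_of_hsSq_le V ENNReal.toReal_nonneg
        (by rw [ENNReal.ofReal_toReal hX]; exact hsSq_le_traceNorm hV) _
    have h2 : ∑ i, ‖Q.adjoint (ket i)‖ ^ 2 ≤ (traceNorm X).toReal + d * k * ε := by
      refine sum_norm_sq_le_of_hsSq_le _ (by positivity) ?_ _
      rw [hsSq_adjoint, hsSq_eq_tsum, hQ, ENNReal.ofReal_add (by positivity) (by positivity),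
        ENNReal.ofReal_toReal hX, traceNorm, tsum_fintype, tsum_fintype]
      have h3 : ENNReal.ofReal (d * k * ε) = ∑ _i : Fin d × Fin k, ENNReal.ofReal ε := by
        rw [Finset.sum_const, ENNReal.ofReal_mul (by positivity)]
        simp [ENNReal.ofReal_mul]
      rw [h3, ← Finset.sum_add_distrib]
      refine Finset.sum_le_sum fun i _ => ?_
      refine le_trans (ENNReal.ofReal_le_ofReal (le_of_eq ?_)) ENNReal.ofReal_add_le
      rw [add_apply, inner_add_right, smul_apply, one_apply_eq_self, inner_smul_right,
        inner_self_eq_norm_sq_to_K, norm_ket]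
      simp
    have h6 : ampliation k Φ X =
        ∑ i, ampliation k Φ (rankOne ℂ (V (ket i)) (Q.adjoint (ket i))) := by
      rw [hVQ, eq_sum_rankOne, ampliation_sum]
    rw [h6]
    refine (traceNorm_sum_le _ _).trans ((Finset.sum_le_sum fun i _ =>
      traceNorm_ampliation_rankOne_le Φ hc h _ _).trans ?_)
    rw [← ENNReal.ofReal_sum_of_nonneg fun i _ => by positivity]
    refine ENNReal.ofReal_le_ofReal ?_
    rw [← Finset.mul_sum]
    have h4 : ∑ i, ‖V (ket i)‖ * ‖Q.adjoint (ket i)‖ ≤ (traceNorm X).toReal + d * k * ε := by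
      have h5 : ∑ i, ‖V (ket i)‖ * ‖Q.adjoint (ket i)‖ ≤
          ∑ i, (‖V (ket i)‖ ^ 2 + ‖Q.adjoint (ket i)‖ ^ 2) / 2 :=
        Finset.sum_le_sum fun i _ => by
          nlinarith only [sq_nonneg (‖V (ket i)‖ - ‖Q.adjoint (ket i)‖)]
      rw [← Finset.sum_div, Finset.sum_add_distrib] at h5
      have : 0 ≤ d * k * ε := by positivity
      linarith
    calc _ ≤ d * c * ((traceNorm X).toReal + d * k * ε) := by gcongr
      _ = _ := by ring
  rw [← ENNReal.ofReal_toReal hX, ← ENNReal.ofReal_mul (by positivity)]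
  have hfin : traceNorm (ampliation k Φ X) ≠ ∞ :=
    ne_top_of_le_ne_top ENNReal.ofReal_ne_top (key 1 one_pos)
  rw [← ENNReal.ofReal_toReal hfin]
  refine ENNReal.ofReal_le_ofReal (le_of_forall_pos_le_add fun ε hε => ?_)
  set C : ℝ := d * c * (d * k) with hC
  have hC0 : 0 ≤ C := mul_nonneg (mul_nonneg (Nat.cast_nonneg _) hc) (by positivity)
  have hC1 : 0 < C + 1 := by linarith
  have h1 := key (ε / (C + 1)) (div_pos hε hC1)
  rw [← ENNReal.ofReal_toReal hfin] at h1
  have h2 : 0 ≤ C * (ε / (C + 1)) := mul_nonneg hC0 (div_pos hε hC1).le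
  have h0 : 0 ≤ d * c * (traceNorm X).toReal :=
    mul_nonneg (mul_nonneg (Nat.cast_nonneg _) hc) ENNReal.toReal_nonneg
  rw [ENNReal.ofReal_le_ofReal_iff (by linarith)] at h1
  refine h1.trans ?_
  have h3 : C * (ε / (C + 1)) ≤ ε := by
    rw [← mul_div_assoc, div_le_iff₀ hC1]
    nlinarith only [hε, hC0]
  linarith

lemma diamondNorm_le_of_matrixUnit (Φ : Op (Fin d) →ₗ[ℂ] Op κ) {c : ℝ} (hc : 0 ≤ c)
    (h : ∀ s t, traceNorm (Φ (matrixUnit s t)) ≤ ENNReal.ofReal c) :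
    diamondNorm Φ ≤ ENNReal.ofReal (d * c) :=
  iSup₂_le fun _ X => ENNReal.div_le_of_le_mul (traceNorm_ampliation_le Φ hc h X)

end

/-! ### Commutation of local operators and the convexity gap -/

section

open InnerProductSpace (rankOne)

section Commute

variable {n : ℕ} {β : Fin n → Type*}

lemma slice_ket {γ : Type*} [DecidableEq γ] (e : κ ≃ ι × γ) (c : γ) (k : κ) :
    slice e c (ket k) = if (e k).2 = c then ket (e k).1 else 0 := by
  classical
  ext b
  rw [slice_apply, ket_apply]
  split_ifs with h1 h2 h2
  · subst h1
    simp [ket_apply]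
  · subst h1
    simp at h2
  · subst h2
    rw [ket_apply, if_neg]
    · rintro rfl
      exact h1 (by simp)
  · rfl

lemma lift_ket_apply {γ : Type*} [DecidableEq γ] (e : κ ≃ ι × γ) (K : Op ι) (k l : κ) :
    lift e K (ket k) l = if (e k).2 = (e l).2 then K (ket (e k).1) (e l).1 else 0 := by
  rw [lift_apply, slice_ket]
  split_ifs <;> simp

/-- The matrix entries of a product of operators on distinct factors are symmetric in the two
factors, which is what `commute_lift` needs. -/
lemma lift_mul_lift_ket_apply {i j : Fin n} (hij : i ≠ j) (K : Op (β i)) (L : Op (β j))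
    (g f : ∀ l, β l) [Decidable (∀ l, l ≠ i → l ≠ j → g l = f l)] :
    (lift (Equiv.piSplitAt i β) K * lift (Equiv.piSplitAt j β) L) (ket g) f =
      if (∀ l, l ≠ i → l ≠ j → g l = f l) then K (ket (g i)) (f i) * L (ket (g j)) (f j)
      else 0 := by
  classical
  rw [mul_apply_eq_comp, lift_apply]
  have h : slice (Equiv.piSplitAt i β) ((Equiv.piSplitAt i β) f).2
      (lift (Equiv.piSplitAt j β) L (ket g)) =
      (if (∀ l, l ≠ i → l ≠ j → g l = f l) then L (ket (g j)) (f j) else 0) • ket (g i) := by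
    ext b
    rw [slice_apply, lift_ket_apply, lp.coeFn_smul, Pi.smul_apply, ket_apply]
    have h0 : ∀ l, (Equiv.piSplitAt i β).symm (b, ((Equiv.piSplitAt i β) f).2) l =
        if h : l = i then h ▸ b else f l := by
      intro l
      simp only [Equiv.piSplitAt_symm_apply, Equiv.piSplitAt_apply]
    have h1 : (Equiv.piSplitAt i β).symm (b, ((Equiv.piSplitAt i β) f).2) j = f j := by
      rw [h0, dif_neg (Ne.symm hij)]
    have h2 : ((Equiv.piSplitAt j β) g).2 = ((Equiv.piSplitAt j β)
        ((Equiv.piSplitAt i β).symm (b, ((Equiv.piSplitAt i β) f).2))).2 ↔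
        (∀ l, l ≠ i → l ≠ j → g l = f l) ∧ b = g i := by
      constructor
      · intro h
        have h3 : ∀ l, l ≠ j → g l =
            (Equiv.piSplitAt i β).symm (b, ((Equiv.piSplitAt i β) f).2) l := fun l hl =>
          congrFun h ⟨l, hl⟩
        refine ⟨fun l hi hj => ?_, ?_⟩
        · rw [h3 l hj, h0, dif_neg hi]
        · rw [h3 i hij, h0, dif_pos rfl]
      · rintro ⟨h, rfl⟩
        ext ⟨l, hl⟩
        change g l = (Equiv.piSplitAt i β).symm (g i, ((Equiv.piSplitAt i β) f).2) l
        rw [h0]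
        split_ifs with h3
        · subst h3; rfl
        · exact h l h3 hl
    have h4 : ((Equiv.piSplitAt j β)
        ((Equiv.piSplitAt i β).symm (b, ((Equiv.piSplitAt i β) f).2))).1 = f j := h1
    have h5 : ((Equiv.piSplitAt j β) g).1 = g j := rfl
    simp only [h2, h4, h5]
    by_cases h6 : ∀ l, l ≠ i → l ≠ j → g l = f l <;> by_cases h7 : b = g i <;> simp [h6, h7]
  rw [h, map_smul, lp.coeFn_smul, Pi.smul_apply]
  have h8 : ((Equiv.piSplitAt i β) f).1 = f i := rfl
  rw [h8]
  split_ifs <;> simp [mul_comm]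

lemma commute_lift {i j : Fin n} (hij : i ≠ j) (K : Op (β i)) (L : Op (β j)) :
    Commute (lift (Equiv.piSplitAt i β) K) (lift (Equiv.piSplitAt j β) L) := by
  classical
  refine clm_ext fun g => ?_
  ext f
  rw [lift_mul_lift_ket_apply hij, lift_mul_lift_ket_apply hij.symm]
  have : (∀ l, l ≠ i → l ≠ j → g l = f l) ↔ ∀ l, l ≠ j → l ≠ i → g l = f l :=
    ⟨fun h l a b => h l b a, fun h l a b => h l b a⟩
  simp only [this, mul_comm]

end Commute

lemma norm_sq_smul_add_smul {E : Type*} [NormedAddCommGroup E] [InnerProductSpace ℂ E] (x y : E)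
    (a b : ℝ) : ‖(a : ℂ) • x + (b : ℂ) • y‖ ^ 2 =
      a ^ 2 * ‖x‖ ^ 2 + 2 * (a * b) * (inner ℂ x y).re + b ^ 2 * ‖y‖ ^ 2 := by
  rw [@norm_add_sq ℂ, norm_smul, norm_smul, inner_smul_left, inner_smul_right, mul_pow, mul_pow,
    Complex.norm_real, Complex.norm_real, Real.norm_eq_abs, Real.norm_eq_abs, sq_abs, sq_abs]
  simp
  ring

/-- The convexity gap of `m ↦ ‖m‖² / t` when `(m, t)` is split into two halves. -/
lemma sq_div_add_sq_div_le {E : Type*} [NormedAddCommGroup E] [InnerProductSpace ℂ E] (m l : E)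
    (t u : ℝ) (hp : ‖m + l‖ ≤ t + u) (hm : ‖m - l‖ ≤ t - u) :
    ‖m‖ ^ 2 / t + ‖l - ((u / t : ℝ) : ℂ) • m‖ ^ 2 / t ≤
      ‖(2⁻¹ : ℂ) • (m + l)‖ ^ 2 / ((t + u) / 2) + ‖(2⁻¹ : ℂ) • (m - l)‖ ^ 2 / ((t - u) / 2) := by
  have hp0 : 0 ≤ t + u := (norm_nonneg _).trans hp
  have hm0 : 0 ≤ t - u := (norm_nonneg _).trans hm
  rcases hp0.eq_or_lt with h | h
  -- One half has zero weight, hence zero vector, and contributes 0/0 = 0; the inequality is then an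
  -- equality.
  · have hl : l = -m := by
      have : m + l = 0 := norm_le_zero_iff.1 (by linarith)
      exact (neg_eq_of_add_eq_zero_right this).symm
    have hu : u = -t := by linarith
    subst hl hu
    rcases eq_or_ne t 0 with rfl | ht
    · simp
    · have : (2⁻¹ : ℂ) • (m - -m) = m := by
        rw [sub_neg_eq_add, ← two_smul ℂ m, smul_smul]; norm_num
      rw [this]
      simp [neg_div, div_self ht]
  rcases hm0.eq_or_lt with h' | h'
  · have hl : l = m := by
      have : m - l = 0 := norm_le_zero_iff.1 (by linarith)
      exact (sub_eq_zero.1 this).symm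
    have hu : u = t := by linarith
    subst hl hu
    rcases eq_or_ne u 0 with rfl | ht
    · simp
    · have : (2⁻¹ : ℂ) • (l + l) = l := by
        rw [← two_smul ℂ l, smul_smul]; norm_num
      rw [this]
      simp [div_self ht]
  have ht : 0 < t := by linarith
  set v := u / t with hv
  have hu : u = v * t := by rw [hv]; field_simp
  have h1 : 0 < 1 + v := by
    rw [hu] at h
    nlinarith
  have h2 : 0 < 1 - v := by
    rw [hu] at h'
    nlinarith
  -- The halves are ((1±v)m ± τ)/2 with weights (1±v)t/2. The terms linear in τ cancel and the
  -- squares of m recombine to ‖m‖²/t, leaving ‖τ‖²/((1-v²)t) ≥ ‖τ‖²/t.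
  set τ := l - (v : ℂ) • m with hτ
  have e1 : (2⁻¹ : ℂ) • (m + l) = (((1 + v) / 2 : ℝ) : ℂ) • m + (2⁻¹ : ℂ) • τ := by
    rw [hτ]; push_cast; module
  have e2 : (2⁻¹ : ℂ) • (m - l) = (((1 - v) / 2 : ℝ) : ℂ) • m - (2⁻¹ : ℂ) • τ := by
    rw [hτ]; push_cast; module
  set r : ℝ := (inner ℂ m τ).re
  have n1 : ‖(2⁻¹ : ℂ) • (m + l)‖ ^ 2 =
      ((1 + v) / 2) ^ 2 * ‖m‖ ^ 2 + (1 + v) / 2 * r + ‖τ‖ ^ 2 / 4 := by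
    have := norm_sq_smul_add_smul m τ ((1 + v) / 2) 2⁻¹
    rw [e1]
    push_cast at this ⊢
    rw [this]
    ring
  have n2 : ‖(2⁻¹ : ℂ) • (m - l)‖ ^ 2 =
      ((1 - v) / 2) ^ 2 * ‖m‖ ^ 2 - (1 - v) / 2 * r + ‖τ‖ ^ 2 / 4 := by
    have := norm_sq_smul_add_smul m τ ((1 - v) / 2) (-2⁻¹)
    rw [e2, sub_eq_add_neg, ← neg_smul]
    push_cast at this ⊢
    rw [this]
    ring
  have e3 : (t + u) / 2 = (1 + v) * t / 2 := by rw [hu]; ring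
  have e4 : (t - u) / 2 = (1 - v) * t / 2 := by rw [hu]; ring
  rw [n1, n2, e3, e4]
  have e5 : (((1 + v) / 2) ^ 2 * ‖m‖ ^ 2 + (1 + v) / 2 * r + ‖τ‖ ^ 2 / 4) / ((1 + v) * t / 2) +
      (((1 - v) / 2) ^ 2 * ‖m‖ ^ 2 - (1 - v) / 2 * r + ‖τ‖ ^ 2 / 4) / ((1 - v) * t / 2) -
      (‖m‖ ^ 2 / t + ‖τ‖ ^ 2 / t) = ‖τ‖ ^ 2 * v ^ 2 / ((1 + v) * (1 - v) * t) := by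
    field_simp
    ring
  have e6 : 0 ≤ ‖τ‖ ^ 2 * v ^ 2 / ((1 + v) * (1 - v) * t) := by positivity
  linarith

end

/-! ### Effects pulled back through a positive trace-preserving map -/

section

open InnerProductSpace (rankOne)

variable {d : ℕ} {Λ : Op (Fin d) →ₗ[ℂ] Op κ}

/-- Positive trace-preserving maps. -/
structure IsPositiveTP (Λ : Op (Fin d) →ₗ[ℂ] Op κ) : Prop where
  nonneg : ∀ X, 0 ≤ X → 0 ≤ Λ X
  tracePreserving : IsTracePreserving Λ

namespace IsPositiveTP

lemma isTraceClass (hΛ : IsPositiveTP Λ) (X : Op (Fin d)) : IsTraceClass (Λ X) :=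
  (hΛ.tracePreserving X).1

lemma mem_traceClassSpan (hΛ : IsPositiveTP Λ) (X : Op (Fin d)) : Λ X ∈ traceClassSpan κ := by
  have hX : X ∈ Submodule.span ℂ {a : Op (Fin d) | 0 ≤ a} := by
    rw [CStarAlgebra.span_nonneg]; trivial
  induction hX using Submodule.span_induction with
  | mem P hP => exact Submodule.subset_span ⟨hΛ.nonneg P hP, hΛ.isTraceClass P⟩
  | zero => simp
  | add S T _ _ hS hT => rw [map_add]; exact add_mem hS hT
  | smul a T _ hT => rw [map_smul]; exact Submodule.smul_mem _ _ hT

/-- The functional `X ↦ tr (N Λ(X))`. -/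
def pairing (hΛ : IsPositiveTP Λ) (N : Op κ) : Op (Fin d) →ₗ[ℂ] ℂ where
  toFun X := trace (N * Λ X)
  map_add' X Y := by
    rw [map_add, mul_add, trace_add ((hΛ.isTraceClass X).mul_left N) ((hΛ.isTraceClass Y).mul_left N)]
  map_smul' c X := by
    rw [map_smul, mul_smul_comm, trace_smul]; rfl

lemma pairing_apply (hΛ : IsPositiveTP Λ) (N : Op κ) (X : Op (Fin d)) :
    hΛ.pairing N X = trace (N * Λ X) := rfl

lemma pairing_add (hΛ : IsPositiveTP Λ) (M N : Op κ) (X : Op (Fin d)) :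
    hΛ.pairing (M + N) X = hΛ.pairing M X + hΛ.pairing N X := by
  simp only [pairing_apply, add_mul]
  exact trace_add ((hΛ.isTraceClass X).mul_left M) ((hΛ.isTraceClass X).mul_left N)

lemma pairing_smul (hΛ : IsPositiveTP Λ) (c : ℂ) (N : Op κ) (X : Op (Fin d)) :
    hΛ.pairing (c • N) X = c * hΛ.pairing N X := by
  simp only [pairing_apply, smul_mul_assoc, trace_smul]

lemma pairing_sum (hΛ : IsPositiveTP Λ) {J : Type*} (s : Finset J) (N : J → Op κ)
    (X : Op (Fin d)) : hΛ.pairing (∑ k ∈ s, N k) X = ∑ k ∈ s, hΛ.pairing (N k) X := by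
  simp only [pairing_apply, Finset.sum_mul]
  exact trace_sum s fun k _ => (hΛ.isTraceClass X).mul_left (N k)

lemma pairing_nonneg (hΛ : IsPositiveTP Λ) {N : Op κ} (hN : 0 ≤ N) {X : Op (Fin d)} (hX : 0 ≤ X) :
    0 ≤ hΛ.pairing N X := trace_mul_nonneg hN (hΛ.nonneg X hX) (hΛ.isTraceClass X)

lemma pairing_one (hΛ : IsPositiveTP Λ) (X : Op (Fin d)) : hΛ.pairing 1 X = trace X := by
  rw [pairing_apply, one_mul, (hΛ.tracePreserving X).2]

/-- The effect `M` with `tr (M X) = tr (N Λ(X))`. -/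
def effect (hΛ : IsPositiveTP Λ) (N : Op κ) : Op (Fin d) :=
  ∑ s, ∑ t, hΛ.pairing N (matrixUnit s t) • matrixUnit t s

end IsPositiveTP

lemma trace_matrixUnit_mul [Fintype ι] (s t : ι) (X : Op ι) :
    trace (matrixUnit t s * X) = X (ket t) s := by
  classical
  rw [trace, tsum_fintype]
  simp [matrixUnit_apply, inner_ket_left, ket_apply, apply_ite]

lemma trace_matrixUnit [Fintype ι] [DecidableEq ι] (s t : ι) :
    trace (matrixUnit s t : Op ι) = if s = t then 1 else 0 := by
  have := trace_matrixUnit_mul t s (1 : Op ι)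
  rw [mul_one, one_apply_eq_self, ket_apply] at this
  rw [this]
  simp [eq_comm]

lemma eq_sum_matrixUnit [Fintype ι] (X : Op ι) :
    X = ∑ s, ∑ t, (X (ket t) s) • matrixUnit s t := by
  classical
  refine clm_ext fun i => ?_
  simp only [sum_apply, smul_apply, matrixUnit_apply, ket_apply]
  conv_lhs => rw [← sum_smul_ket (X (ket i))]
  simp [ite_smul]

lemma one_eq_sum_matrixUnit [Fintype ι] : (1 : Op ι) = ∑ s, matrixUnit s s := by
  refine clm_ext fun i => ?_
  conv_lhs => rw [← sum_smul_ket (ket i)]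
  simp [sum_apply, matrixUnit_apply, map_sum]

namespace IsPositiveTP

lemma trace_effect_mul (hΛ : IsPositiveTP Λ) (N : Op κ) (X : Op (Fin d)) :
    trace (hΛ.effect N * X) = hΛ.pairing N X := by
  have hfin : ∀ Y : Op (Fin d), IsTraceClass Y := traceNorm_ne_top_of_fintype
  conv_rhs => rw [eq_sum_matrixUnit X]
  simp only [effect, Finset.sum_mul, map_sum, map_smul]
  rw [trace_sum _ fun _ _ => hfin _]
  refine Finset.sum_congr rfl fun s _ => ?_
  rw [trace_sum _ fun _ _ => hfin _]
  refine Finset.sum_congr rfl fun t _ => ?_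
  rw [smul_mul_assoc, trace_smul, trace_matrixUnit_mul, smul_eq_mul, mul_comm]

lemma effect_ket (hΛ : IsPositiveTP Λ) (N : Op κ) (s t : Fin d) :
    hΛ.effect N (ket s) t = hΛ.pairing N (matrixUnit s t) := by
  rw [← inner_ket_left]
  simp [effect, sum_apply, matrixUnit_apply, inner_ket_left, ket_apply]

/-- The quadratic form of the effect at x is tr(N Λ(|x⟩⟨x|)), a pairing of positive operators. -/
lemma effect_nonneg (hΛ : IsPositiveTP Λ) {N : Op κ} (hN : 0 ≤ N) : 0 ≤ hΛ.effect N := by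
  rw [nonneg_iff]
  intro x
  have h : inner ℂ x (hΛ.effect N x) = hΛ.pairing N (rankOne ℂ x x) := by
    rw [rankOne_eq_sum]
    simp only [effect, sum_apply, smul_apply, matrixUnit_apply, inner_sum, inner_smul_right,
      map_sum, map_smul, smul_eq_mul]
    refine Finset.sum_congr rfl fun s _ => Finset.sum_congr rfl fun t _ => ?_
    rw [← inner_conj_symm, inner_ket_left, RCLike.star_def]
    ring
  rw [h]
  exact hΛ.pairing_nonneg hN
    ((ContinuousLinearMap.nonneg_iff_isPositive _).2 (InnerProductSpace.isPositive_rankOne_self x))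

lemma effect_one (hΛ : IsPositiveTP Λ) : hΛ.effect 1 = 1 := by
  classical
  conv_rhs => rw [one_eq_sum_matrixUnit]
  simp [effect, pairing_one, trace_matrixUnit, ite_smul]

lemma sum_effect (hΛ : IsPositiveTP Λ) {J : Type*} (s : Finset J) (N : J → Op κ) :
    ∑ k ∈ s, hΛ.effect (N k) = hΛ.effect (∑ k ∈ s, N k) := by
  simp only [effect, pairing_sum, Finset.sum_smul]
  rw [Finset.sum_comm]
  exact Finset.sum_congr rfl fun _ _ => Finset.sum_comm

/-- The matrix entries of the effect, as a Hilbert-Schmidt vector. -/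
def vec (hΛ : IsPositiveTP Λ) (N : Op κ) : EuclideanSpace ℂ (Fin d × Fin d) :=
  WithLp.toLp 2 fun p => hΛ.pairing N (matrixUnit p.1 p.2)

/-- The trace of the effect. -/
def mass (hΛ : IsPositiveTP Λ) (N : Op κ) : ℝ := (hΛ.pairing N 1).re

lemma vec_add (hΛ : IsPositiveTP Λ) (M N : Op κ) : hΛ.vec (M + N) = hΛ.vec M + hΛ.vec N := by
  ext p; simp [vec, pairing_add]

lemma vec_smul (hΛ : IsPositiveTP Λ) (c : ℂ) (N : Op κ) : hΛ.vec (c • N) = c • hΛ.vec N := by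
  ext p; simp [vec, pairing_smul]

lemma ofReal_mass (hΛ : IsPositiveTP Λ) {N : Op κ} (hN : 0 ≤ N) :
    (hΛ.mass N : ℂ) = hΛ.pairing N 1 := by
  have h := Complex.nonneg_iff.1 (hΛ.pairing_nonneg hN zero_le_one)
  exact Complex.ext rfl h.2

lemma mass_nonneg (hΛ : IsPositiveTP Λ) {N : Op κ} (hN : 0 ≤ N) : 0 ≤ hΛ.mass N :=
  (Complex.nonneg_iff.1 (hΛ.pairing_nonneg hN zero_le_one)).1

/-- The Hilbert-Schmidt norm of a positive matrix is at most its trace: its entries are inner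
products of the columns of its square root, and Cauchy-Schwarz applies to each. This bounds the
potential and makes outcomes of mass zero vanish. -/
lemma norm_vec_le (hΛ : IsPositiveTP Λ) {N : Op κ} (hN : 0 ≤ N) : ‖hΛ.vec N‖ ≤ hΛ.mass N := by
  obtain ⟨S, hS0, hSS, -⟩ := exists_nonneg_sqrt (hΛ.effect_nonneg hN)
  have hSs : star S = S := (IsSelfAdjoint.of_nonneg hS0).star_eq
  have h1 : ∀ s t, hΛ.pairing N (matrixUnit s t) = inner ℂ (S (ket t)) (S (ket s)) := by
    intro s t
    rw [← effect_ket, ← inner_ket_left, ← hSS, mul_apply_eq_comp,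
      ← ContinuousLinearMap.adjoint_inner_left, ← ContinuousLinearMap.star_eq_adjoint, hSs]
  have h2 : hΛ.mass N = ∑ s, ‖S (ket s)‖ ^ 2 := by
    rw [mass, one_eq_sum_matrixUnit, map_sum, Complex.re_sum]
    refine Finset.sum_congr rfl fun s _ => ?_
    rw [h1, inner_self_eq_norm_sq_to_K]
    norm_cast
  refine abs_le_of_sq_le_sq' ?_ (hΛ.mass_nonneg hN) |>.2
  rw [EuclideanSpace.norm_sq_eq, Fintype.sum_prod_type, h2, sq, Finset.sum_mul_sum]
  refine Finset.sum_le_sum fun s _ => Finset.sum_le_sum fun t _ => ?_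
  change ‖hΛ.pairing N (matrixUnit s t)‖ ^ 2 ≤ _
  rw [h1, ← mul_pow, mul_comm]
  gcongr
  exact norm_inner_le_norm _ _

end IsPositiveTP

end

/-! ### Conditional states, probes and the growth of the potential -/

section

variable {d n : ℕ}

lemma isState_partialTrace {γ : Type*} (e : κ ≃ ι × γ) {T : Op κ} (hT0 : 0 ≤ T)
    (hT : IsTraceClass T) {c : ℝ} (hc : 0 < c) (htr : trace T = c) :
    IsState ((c⁻¹ : ℂ) • partialTrace e T) := by
  have hm : T ∈ traceClassSpan κ := Submodule.subset_span ⟨hT0, hT⟩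
  refine ⟨?_, (isTraceClass_partialTrace e hm).smul _, ?_⟩
  · have h := partialTrace_nonneg e hT0
    rw [nonneg_iff] at h ⊢
    intro x
    rw [smul_apply, inner_smul_right]
    refine mul_nonneg ?_ (h x)
    rw [← Complex.ofReal_inv]
    exact_mod_cast (inv_pos.2 hc).le
  · have h := trace_mul_partialTrace e hm 1
    rw [lift_one, one_mul, one_mul, htr] at h
    rw [trace_smul, h, inv_mul_cancel₀]
    exact_mod_cast hc.ne'

namespace IsPositiveTP

/-- The state is the normalised partial trace of RΛ(1)R with R = N^{1/2}, the post-measurement state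
for the maximally mixed input. R commutes with K ⊗ 1 because N does, so the two copies of R
recombine to N inside the trace. -/
lemma exists_conditional_state {γ : Type*} (e : κ ≃ ι × γ) {Λ : Op (Fin d) →ₗ[ℂ] Op κ}
    (hΛ : IsPositiveTP Λ) (hd : 0 < d) {N : Op κ} (hN : 0 ≤ N)
    (hcomm : ∀ K, Commute N (lift e K)) :
    ∃ σ : Op ι, IsState σ ∧ (hΛ.mass N ≠ 0 → ∀ K,
      trace (K * σ) = hΛ.pairing (N * lift e K) 1 / hΛ.mass N) := by
  have h1 : 0 ≤ Λ 1 := hΛ.nonneg 1 zero_le_one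
  -- For an outcome of mass zero any state serves; the marginal of Λ(1)/d is taken.
  by_cases hm : hΛ.mass N = 0
  · refine ⟨_, isState_partialTrace e h1 (hΛ.isTraceClass 1) (c := d) (by exact_mod_cast hd) ?_,
      fun h => absurd hm h⟩
    classical
    rw [(hΛ.tracePreserving 1).2, one_eq_sum_matrixUnit,
      trace_sum _ fun _ _ => traceNorm_ne_top_of_fintype _]
    simp [trace_matrixUnit]
  · obtain ⟨R, hR0, hRR, hRc⟩ := exists_nonneg_sqrt hN
    have hpos : 0 < hΛ.mass N := lt_of_le_of_ne (hΛ.mass_nonneg hN) (Ne.symm hm)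
    have hT0 : 0 ≤ R * Λ 1 * R := mul_mul_self_nonneg h1 hR0
    have hT : IsTraceClass (R * Λ 1 * R) := ((hΛ.isTraceClass 1).mul_left R).mul_right R
    refine ⟨_, isState_partialTrace e hT0 hT hpos ?_, fun _ K => ?_⟩
    · rw [trace_mul_mul_comm h1 (hΛ.isTraceClass 1), hRR, hΛ.ofReal_mass hN, pairing_apply]
    · have hm' : R * Λ 1 * R ∈ traceClassSpan κ := Submodule.subset_span ⟨hT0, hT⟩
      rw [mul_smul_comm, trace_smul, trace_mul_partialTrace e hm', ← mul_assoc, ← mul_assoc,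
        trace_mul_mul_comm h1 (hΛ.isTraceClass 1), pairing_apply, ← mul_assoc R,
        (hRc _ (hcomm K)).eq, mul_assoc _ R R, hRR, ← (hcomm K).eq, div_eq_inv_mul]

lemma mass_one {Λ : Op (Fin d) →ₗ[ℂ] Op κ} (hΛ : IsPositiveTP Λ) : hΛ.mass 1 = d := by
  classical
  rw [mass, pairing_one, one_eq_sum_matrixUnit,
    trace_sum _ fun _ _ => traceNorm_ne_top_of_fintype _]
  simp [trace_matrixUnit]

lemma sum_mass {Λ : Op (Fin d) →ₗ[ℂ] Op κ} (hΛ : IsPositiveTP Λ) {J : Type*} [Fintype J]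
    {N : J → Op κ} (hN : ∑ k, N k = 1) : ∑ k, hΛ.mass (N k) = d := by
  rw [← hΛ.mass_one, ← hN, mass, pairing_sum, Complex.re_sum]
  rfl

/-- The quadratic potential of a family of effects. -/
def potential {Λ : Op (Fin d) →ₗ[ℂ] Op κ} (hΛ : IsPositiveTP Λ) {J : Type*} [Fintype J]
    (N : J → Op κ) : ℝ := ∑ k, ‖hΛ.vec (N k)‖ ^ 2 / hΛ.mass (N k)

/-- Each term is at most the mass of its outcome by `norm_vec_le`, and the masses sum to d. -/
lemma potential_le {Λ : Op (Fin d) →ₗ[ℂ] Op κ} (hΛ : IsPositiveTP Λ) {J : Type*} [Fintype J]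
    {N : J → Op κ} (hN0 : ∀ k, 0 ≤ N k) (hN : ∑ k, N k = 1) : hΛ.potential N ≤ d := by
  rw [← hΛ.sum_mass hN]
  refine Finset.sum_le_sum fun k _ => div_le_of_le_mul₀ (hΛ.mass_nonneg (hN0 k))
    (hΛ.mass_nonneg (hN0 k)) ?_
  rw [← sq]
  gcongr
  exact hΛ.norm_vec_le (hN0 k)

lemma potential_nonneg {Λ : Op (Fin d) →ₗ[ℂ] Op κ} (hΛ : IsPositiveTP Λ) {J : Type*} [Fintype J]
    {N : J → Op κ} (hN0 : ∀ k, 0 ≤ N k) : 0 ≤ hΛ.potential N :=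
  Finset.sum_nonneg fun k _ => div_nonneg (sq_nonneg _) (hΛ.mass_nonneg (hN0 k))

end IsPositiveTP

variable {β : Fin n → Type*}

/-- A measurement on the subsystems in `C`, as a POVM on the composite system. -/
structure IsProbe {J : Type*} [Fintype J] (C : Finset (Fin n)) (N : J → Op (∀ i, β i)) : Prop where
  nonneg : ∀ k, 0 ≤ N k
  sum_eq_one : ∑ k, N k = 1
  commute : ∀ k, ∀ j ∉ C, ∀ K, Commute (N k) (lift (Equiv.piSplitAt j β) K)

lemma isProbe_one : IsProbe (β := β) ∅ fun _ : Unit => 1 where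
  nonneg _ := zero_le_one
  sum_eq_one := by simp
  commute _ _ _ _ := Commute.one_left _

/-- The refinement of a family of effects by the two-outcome measurement `(1 ± K) / 2`. -/
def refineProbe {J : Type*} (N : J → Op (∀ i, β i)) (j : Fin n) (K : Op (β j)) :
    J ⊕ J → Op (∀ i, β i) :=
  Sum.elim (fun k => N k * lift (Equiv.piSplitAt j β) ((2⁻¹ : ℂ) • (1 + K)))
    fun k => N k * lift (Equiv.piSplitAt j β) ((2⁻¹ : ℂ) • (1 - K))

lemma half_smul_nonneg {H : Type*} [NormedAddCommGroup H] [InnerProductSpace ℂ H]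
    {P : H →L[ℂ] H} (hP : 0 ≤ P) : 0 ≤ (2⁻¹ : ℂ) • P := by
  rw [nonneg_iff] at hP ⊢
  intro x
  rw [smul_apply, inner_smul_right]
  exact mul_nonneg (by positivity) (hP x)

lemma one_add_nonneg {H : Type*} [NormedAddCommGroup H] [InnerProductSpace ℂ H] [CompleteSpace H]
    {K : H →L[ℂ] H} (hK : IsSelfAdjoint K) (hK1 : ‖K‖ ≤ 1) : 0 ≤ 1 + K := by
  have h := hK.neg_algebraMap_norm_le_self
  have h1 : algebraMap ℝ (H →L[ℂ] H) ‖K‖ ≤ algebraMap ℝ _ 1 := algebraMap_mono _ hK1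
  rw [map_one] at h1
  have h2 : -1 ≤ K := (neg_le_neg h1).trans h
  have := sub_nonneg.2 h2
  rwa [sub_neg_eq_add, add_comm] at this

lemma IsProbe.refine {J : Type*} [Fintype J] {C : Finset (Fin n)} {N : J → Op (∀ i, β i)}
    (hN : IsProbe C N) {j : Fin n} (hj : j ∉ C) {K : Op (β j)} (hK : IsSelfAdjoint K)
    (hK1 : ‖K‖ ≤ 1) : IsProbe (insert j C) (refineProbe N j K) where
  nonneg k := by
    have hm : 0 ≤ 1 - K := by
      have := one_add_nonneg hK.neg ((norm_neg K).trans_le hK1)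
      rwa [← sub_eq_add_neg] at this
    rcases k with k | k
    · exact mul_nonneg_of_commute (hN.nonneg k)
        (lift_nonneg _ (half_smul_nonneg (one_add_nonneg hK hK1))) (hN.commute k j hj _)
    · exact mul_nonneg_of_commute (hN.nonneg k)
        (lift_nonneg _ (half_smul_nonneg hm)) (hN.commute k j hj _)
  sum_eq_one := by
    rw [Fintype.sum_sum_type]
    simp only [refineProbe, Sum.elim_inl, Sum.elim_inr]
    rw [← Finset.sum_mul, ← Finset.sum_mul, hN.sum_eq_one, one_mul, one_mul, ← lift_add,
      ← smul_add, show (1 : Op (β j)) + K + (1 - K) = (2 : ℂ) • 1 by module, smul_smul]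
    norm_num [lift_one]
  commute k i hi L := by
    rw [Finset.mem_insert, not_or] at hi
    rcases k with k | k
    · exact (hN.commute k i hi.2 L).mul_left (commute_lift (Ne.symm hi.1) _ _)
    · exact (hN.commute k i hi.2 L).mul_left (commute_lift (Ne.symm hi.1) _ _)

/-- The potential gained by a refinement controls the deviation from the measure-and-prepare map. -/
lemma IsProbe.sq_norm_trace_le {Λ : Op (Fin d) →ₗ[ℂ] Op (∀ i, β i)} (hΛ : IsPositiveTP Λ)
    {J : Type*} [Fintype J] {C : Finset (Fin n)} {N : J → Op (∀ i, β i)}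
    (hN : IsProbe C N) {j : Fin n} (hj : j ∉ C) {K : Op (β j)} (hK : IsSelfAdjoint K)
    (hK1 : ‖K‖ ≤ 1) {σ : J → Op (β j)} (hσ : ∀ k, IsState (σ k))
    (hσN : ∀ k, hΛ.mass (N k) ≠ 0 → ∀ K, trace (K * σ k) =
      hΛ.pairing (N k * lift (Equiv.piSplitAt j β) K) 1 / hΛ.mass (N k)) (s t : Fin d) :
    ‖trace (K * (partialTrace (Equiv.piSplitAt j β) (Λ (matrixUnit s t)) -
      ∑ k, hΛ.pairing (N k) (matrixUnit s t) • σ k))‖ ^ 2 ≤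
      d * (hΛ.potential (refineProbe N j K) - hΛ.potential N) := by
  set e := Equiv.piSplitAt j β
  set L := lift e K with hL
  set m := fun k => hΛ.vec (N k) with hm
  set l := fun k => hΛ.vec (N k * L) with hl
  set w := fun k => hΛ.mass (N k) with hw
  set u := fun k => (hΛ.pairing (N k * L) 1).re with hu
  have hR := hN.refine hj hK hK1
  have hw0 : ∀ k, 0 ≤ w k := fun k => hΛ.mass_nonneg (hN.nonneg k)
  have hplus : ∀ k, refineProbe N j K (Sum.inl k) = (2⁻¹ : ℂ) • (N k + N k * L) := fun k => by
    simp only [refineProbe, Sum.elim_inl, lift_smul, lift_add, lift_one, mul_smul_comm, mul_add,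
      mul_one]
    rfl
  have hminus : ∀ k, refineProbe N j K (Sum.inr k) =
      (2⁻¹ : ℂ) • (N k + (-1 : ℂ) • (N k * L)) := fun k => by
    simp only [refineProbe, Sum.elim_inr, lift_smul, lift_sub, lift_one, mul_smul_comm, mul_sub,
      mul_one, neg_one_smul, ← sub_eq_add_neg]
    rfl
  have vplus : ∀ k, hΛ.vec (refineProbe N j K (Sum.inl k)) = (2⁻¹ : ℂ) • (m k + l k) := fun k => by
    rw [hplus, hΛ.vec_smul, hΛ.vec_add]
  have vminus : ∀ k, hΛ.vec (refineProbe N j K (Sum.inr k)) = (2⁻¹ : ℂ) • (m k - l k) := fun k => by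
    rw [hminus, hΛ.vec_smul, hΛ.vec_add, hΛ.vec_smul, neg_one_smul, ← sub_eq_add_neg]
  have wplus : ∀ k, hΛ.mass (refineProbe N j K (Sum.inl k)) = (w k + u k) / 2 := fun k => by
    rw [hplus, IsPositiveTP.mass, hΛ.pairing_smul, hΛ.pairing_add]
    simp [hw, hu, IsPositiveTP.mass]
    ring
  have wminus : ∀ k, hΛ.mass (refineProbe N j K (Sum.inr k)) = (w k - u k) / 2 := fun k => by
    rw [hminus, IsPositiveTP.mass, hΛ.pairing_smul, hΛ.pairing_add, hΛ.pairing_smul]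
    simp [hw, hu, IsPositiveTP.mass]
    ring
  have hp : ∀ k, ‖m k + l k‖ ≤ w k + u k := fun k => by
    have := hΛ.norm_vec_le (hR.nonneg (Sum.inl k))
    rw [vplus, wplus, norm_smul] at this
    norm_num at this
    linarith
  have hn : ∀ k, ‖m k - l k‖ ≤ w k - u k := fun k => by
    have := hΛ.norm_vec_le (hR.nonneg (Sum.inr k))
    rw [vminus, wminus, norm_smul] at this
    norm_num at this
    linarith
  -- The pairing is real because it is a combination of the masses of two positive operators.
  have hur : ∀ k, hΛ.pairing (N k * L) 1 = u k := fun k => by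
    have h1 := hΛ.ofReal_mass (hR.nonneg (Sum.inl k))
    have h2 := hΛ.ofReal_mass (hN.nonneg k)
    rw [wplus, hplus, hΛ.pairing_smul, hΛ.pairing_add, ← h2] at h1
    push_cast at h1
    linear_combination -2 * h1
  -- The ratio `u k / w k` is the expectation of K in `σ k`, so the (s, t) entries of `τ k` add up
  -- to the trace of K against the deviation at the matrix unit. The same `τ k` appears in the
  -- convexity gap.
  set τ := fun k => l k - ((u k / w k : ℝ) : ℂ) • m k with hτ
  have hm0 : ∀ k, w k = 0 → m k = 0 := fun k hk =>
    norm_le_zero_iff.1 ((hΛ.norm_vec_le (hN.nonneg k)).trans_eq hk)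
  have hτ0 : ∀ k, w k = 0 → τ k = 0 := fun k hk => by
    have h1 := hp k
    have h2 := hn k
    rw [hk, hm0 k hk, zero_add] at h1
    rw [hk, hm0 k hk, zero_sub, norm_neg, zero_sub] at h2
    have h3 : l k = 0 := norm_le_zero_iff.1 (by linarith)
    simp only [hτ, h3, hm0 k hk, smul_zero, sub_zero]
  have htr : trace (K * (partialTrace e (Λ (matrixUnit s t)) -
      ∑ k, hΛ.pairing (N k) (matrixUnit s t) • σ k)) = ∑ k, τ k (s, t) := by
    have hmem := hΛ.mem_traceClassSpan (matrixUnit s t)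
    have h1 : L = ∑ k, N k * L := by rw [← Finset.sum_mul, hN.sum_eq_one, one_mul]
    have h2 : trace (K * partialTrace e (Λ (matrixUnit s t))) =
        ∑ k, hΛ.pairing (N k * L) (matrixUnit s t) := by
      rw [trace_mul_partialTrace e hmem, ← hΛ.pairing_sum, ← h1, hΛ.pairing_apply]
    have htc : ∀ k, IsTraceClass (K * hΛ.pairing (N k) (matrixUnit s t) • σ k) := fun k =>
      ((hσ k).2.1.smul _).mul_left K
    rw [mul_sub, Finset.mul_sum, trace_sub ((isTraceClass_partialTrace e hmem).mul_left K)
      (IsTraceClass.sum _ fun k _ => htc k), h2, trace_sum _ fun k _ => htc k,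
      ← Finset.sum_sub_distrib]
    refine Finset.sum_congr rfl fun k _ => ?_
    rw [mul_smul_comm, trace_smul]
    have h3 : τ k (s, t) = hΛ.pairing (N k * L) (matrixUnit s t) -
      ((u k / w k : ℝ) : ℂ) * hΛ.pairing (N k) (matrixUnit s t) := rfl
    rw [h3]
    by_cases hk : w k = 0
    · have h4 : hΛ.pairing (N k) (matrixUnit s t) = 0 :=
        congrArg (fun v : EuclideanSpace ℂ (Fin d × Fin d) => v (s, t)) (hm0 k hk)
      rw [h4, zero_mul, mul_zero]
    · rw [hσN k hk, hur k]
      push_cast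
      ring
  have hsum : ‖∑ k, τ k (s, t)‖ ≤ ∑ k, ‖τ k‖ :=
    (norm_sum_le _ _).trans (Finset.sum_le_sum fun k _ => PiLp.norm_apply_le (τ k) (s, t))
  -- Cauchy-Schwarz with weights `w k`, whose total d is the factor in the conclusion.
  have hcs : (∑ k, ‖τ k‖) ^ 2 ≤ (∑ k, w k) * ∑ k, ‖τ k‖ ^ 2 / w k := by
    refine Finset.sum_sq_le_sum_mul_sum_of_sq_le_mul _ (fun k _ => hw0 k)
      (fun k _ => div_nonneg (sq_nonneg _) (hw0 k)) fun k _ => ?_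
    by_cases hk : w k = 0
    · simp [hτ0 k hk]
    · exact (mul_div_cancel₀ _ hk).ge
  have hgain : ∑ k, ‖τ k‖ ^ 2 / w k ≤
      hΛ.potential (refineProbe N j K) - hΛ.potential N := by
    rw [IsPositiveTP.potential, IsPositiveTP.potential, Fintype.sum_sum_type,
      ← Finset.sum_add_distrib, ← Finset.sum_sub_distrib]
    refine Finset.sum_le_sum fun k _ => ?_
    rw [vplus, vminus, wplus, wminus]
    have := sq_div_add_sq_div_le (m k) (l k) (w k) (u k) (hp k) (hn k)
    have h : ‖hΛ.vec (N k)‖ ^ 2 / hΛ.mass (N k) = ‖m k‖ ^ 2 / w k := rfl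
    rw [h]
    linarith
  rw [htr]
  calc ‖∑ k, τ k (s, t)‖ ^ 2 ≤ (∑ k, ‖τ k‖) ^ 2 := by gcongr
    _ ≤ (∑ k, w k) * ∑ k, ‖τ k‖ ^ 2 / w k := hcs
    _ ≤ d * (hΛ.potential (refineProbe N j K) - hΛ.potential N) := by
        rw [hΛ.sum_mass hN.sum_eq_one]
        gcongr

end

/-! ### Greedy choice of the measured subsystems and the final estimates -/

section

open scoped ComplexStarModule

variable {d n : ℕ} {β : Fin n → Type*}

/-- If no probe works, every probe within the cardinality bound can be refined at a new subsystem
with a gain of at least ε²/d. The potential never exceeds d, so the bound persists and the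
refinement never stops, which is impossible with n subsystems. -/
lemma exists_probe_forall_norm_trace_le {Λ : Op (Fin d) →ₗ[ℂ] Op (∀ i, β i)}
    (hΛ : IsPositiveTP Λ) (hd : 0 < d) {ε : ℝ} (hε : 0 < ε) :
    ∃ (C : Finset (Fin n)) (J : Type) (_ : Fintype J) (N : J → Op (∀ i, β i)),
      IsProbe C N ∧ C.card * (ε ^ 2 / d) ≤ d ∧ ∀ j ∉ C, ∃ σ : J → Op (β j),
        (∀ k, IsState (σ k)) ∧ ∀ K : Op (β j), IsSelfAdjoint K → ‖K‖ ≤ 1 → ∀ s t,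
          ‖trace (K * (partialTrace (Equiv.piSplitAt j β) (Λ (matrixUnit s t)) -
            ∑ k, hΛ.pairing (N k) (matrixUnit s t) • σ k))‖ ≤ ε := by
  have hd' : (0 : ℝ) < d := by exact_mod_cast hd
  by_contra hcon
  push Not at hcon
  have key : ∀ r : ℕ, ∃ (C : Finset (Fin n)) (J : Type) (_ : Fintype J)
      (N : J → Op (∀ i, β i)), IsProbe C N ∧ C.card = r ∧
        r * (ε ^ 2 / d) ≤ hΛ.potential N := by
    intro r
    induction r with
    | zero =>
      exact ⟨∅, Unit, inferInstance, fun _ => 1, isProbe_one, rfl, by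
        simpa using hΛ.potential_nonneg (N := fun _ : Unit => (1 : Op (∀ i, β i)))
          isProbe_one.nonneg⟩
    | succ r ih =>
      obtain ⟨C, J, _, N, hN, hC, hpot⟩ := ih
      have hle : (C.card : ℝ) * (ε ^ 2 / d) ≤ d := by
        rw [hC]
        exact hpot.trans (hΛ.potential_le hN.nonneg hN.sum_eq_one)
      obtain ⟨j, hj, hσ⟩ := hcon C J _ N hN hle
      choose σ hσ1 hσ2 using fun k => IsPositiveTP.exists_conditional_state
        (Equiv.piSplitAt j β) hΛ hd (hN.nonneg k) (hN.commute k j hj)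
      obtain ⟨K, hK, hK1, s, t, hst⟩ := hσ σ hσ1
      refine ⟨insert j C, J ⊕ J, inferInstance, refineProbe N j K, hN.refine hj hK hK1,
        by rw [Finset.card_insert_of_notMem hj, hC], ?_⟩
      have h1 := hN.sq_norm_trace_le hΛ hj hK hK1 hσ1 hσ2 s t
      have h2 : ε ^ 2 ≤ d * (hΛ.potential (refineProbe N j K) - hΛ.potential N) :=
        (pow_le_pow_left₀ hε.le hst.le 2).trans h1
      have h3 : ε ^ 2 / d ≤ hΛ.potential (refineProbe N j K) - hΛ.potential N := by
        rwa [div_le_iff₀' hd']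
      push_cast
      linarith
  obtain ⟨C, -, -, -, -, hC, -⟩ := key (n + 1)
  have := C.card_le_univ
  rw [Fintype.card_fin] at this
  omega

/-- A contraction is split into its real and imaginary parts, both self-adjoint contractions; hence
the factor 2. -/
lemma traceNorm_le_of_isSelfAdjoint {T : Op ι} (hT : IsTraceClass T) {c : ℝ}
    (h : ∀ K : Op ι, IsSelfAdjoint K → ‖K‖ ≤ 1 → ‖trace (K * T)‖ ≤ c) :
    traceNorm T ≤ ENNReal.ofReal (2 * c) := by
  refine traceNorm_le_of_norm_trace_le hT fun K hK => ?_
  have h1 := h (ℜ K : Op ι) (ℜ K).2 ((realPart.norm_le K).trans hK)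
  have h2 := h (ℑ K : Op ι) (ℑ K).2 ((imaginaryPart.norm_le K).trans hK)
  have h3 : trace (K * T) =
      trace ((ℜ K : Op ι) * T) + Complex.I * trace ((ℑ K : Op ι) * T) := by
    conv_lhs => rw [← realPart_add_I_smul_imaginaryPart K]
    rw [add_mul, trace_add (hT.mul_left _) (hT.mul_left _), smul_mul_assoc, trace_smul]
  rw [h3]
  refine (norm_add_le _ _).trans ?_
  rw [norm_mul, Complex.norm_I, one_mul]
  linarith

/-- The difference of a reduced map and a measure-and-prepare map. -/
def deviation {γ : Type*} (e : κ ≃ ι × γ) {Λ : Op (Fin d) →ₗ[ℂ] Op κ} (hΛ : IsPositiveTP Λ)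
    {J : Type*} [Fintype J] (N : J → Op κ) (σ : J → Op ι) : Op (Fin d) →ₗ[ℂ] Op ι where
  toFun X := partialTrace e (Λ X) - ∑ k, hΛ.pairing (N k) X • σ k
  map_add' X Y := by
    rw [map_add, partialTrace_add e (hΛ.mem_traceClassSpan X) (hΛ.mem_traceClassSpan Y)]
    simp only [map_add, add_smul, Finset.sum_add_distrib]
    abel
  map_smul' c X := by
    rw [map_smul, partialTrace_smul e c (hΛ.mem_traceClassSpan X)]
    simp only [map_smul, smul_eq_mul, mul_smul, ← Finset.smul_sum, smul_sub, RingHom.id_apply]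

lemma exists_povm_diamondNorm_le {Λ : Op (Fin d) →ₗ[ℂ] Op (∀ i, β i)}
    (hΛ : IsPositiveTP Λ) (hd : 0 < d) {η : ℝ} (hη : 0 < η) :
    ∃ (C : Finset (Fin n)) (m : ℕ) (M : Fin m → Op (Fin d)),
      IsPOVM M ∧ C.card * η ^ 2 ≤ 4 * d ^ 4 ∧ ∀ j ∉ C, ∃ σ : Fin m → Op (β j),
        (∀ k, IsState (σ k)) ∧
        diamondNorm (fun X => marginal j (Λ X) - measurePrepare M σ X) ≤ ENNReal.ofReal η := by
  have hd' : (0 : ℝ) < d := by exact_mod_cast hd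
  obtain ⟨C, J, _, N, hN, hC, hdev⟩ :=
    -- The factor 2 pays for self-adjoint tests and the factor d for passing from matrix units to
    -- the diamond norm.
    exists_probe_forall_norm_trace_le hΛ hd (ε := η / (2 * d)) (by positivity)
  let f := Fintype.equivFin J
  refine ⟨C, Fintype.card J, fun k => hΛ.effect (N (f.symm k)),
    ⟨fun k => hΛ.effect_nonneg (hN.nonneg _), ?_⟩, ?_, fun j hj => ?_⟩
  · rw [hΛ.sum_effect, f.symm.sum_comp, hN.sum_eq_one, hΛ.effect_one]
  · have : (C.card : ℝ) * ((η / (2 * d)) ^ 2 / d) = C.card * η ^ 2 / (4 * d ^ 3) := by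
      field_simp
      ring
    rw [this, div_le_iff₀ (by positivity)] at hC
    linarith
  · obtain ⟨σ, hσ, hσK⟩ := hdev j hj
    refine ⟨fun k => σ (f.symm k), fun k => hσ _, ?_⟩
    have h1 : (fun X => marginal j (Λ X) - measurePrepare (fun k => hΛ.effect (N (f.symm k)))
        (fun k => σ (f.symm k)) X) =
          fun X => deviation (Equiv.piSplitAt j β) hΛ N σ X := by
      ext1 X
      unfold measurePrepare
      simp_rw [hΛ.trace_effect_mul]
      rw [f.symm.sum_comp fun k => hΛ.pairing (N k) X • σ k]
      -- `marginal j` is by definition the partial trace for the splitting `Equiv.piSplitAt j β`.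
      rfl
    rw [h1]
    refine (diamondNorm_le_of_matrixUnit _ (c := η / d) (by positivity) fun s t => ?_).trans_eq
      (by rw [mul_div_cancel₀ _ hd'.ne'])
    have h2 : IsTraceClass (deviation (Equiv.piSplitAt j β) hΛ N σ (matrixUnit s t)) :=
      (isTraceClass_partialTrace _ (hΛ.mem_traceClassSpan _)).sub
        (IsTraceClass.sum _ fun k _ => (hσ k).2.1.smul _)
    refine (traceNorm_le_of_isSelfAdjoint h2 fun K hK hK1 => hσK K hK hK1 s t).trans_eq ?_
    congr 1
    field_simp

/-- Cubing removes the cube root. If c > δn, then 729 n (ln d)²/δ³ ≤ 64, against n ≥ 1, δ ≤ 1, ln d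
> 0.69 and 729 · 0.69² > 64. -/
lemma card_le_of_mul_sq_le {c n d : ℕ} {δ : ℝ} (hd : 2 ≤ d) (hn : 0 < n) (hδ : 0 < δ) (hδ1 : δ ≤ 1)
    (h : c * ((27 * Real.log 2 * (d : ℝ) ^ 6 * Real.logb 2 d / (n * δ ^ 3)) ^ (1 / 3 : ℝ)) ^ 2 ≤
      4 * (d : ℝ) ^ 4) : (c : ℝ) ≤ δ * n := by
  have hn' : (1 : ℝ) ≤ n := by exact_mod_cast hn
  have hd' : (2 : ℝ) ≤ d := by exact_mod_cast hd
  have hl2 : 0.69 < Real.log 2 := by linarith [Real.log_two_gt_d9]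
  have hL : 0.69 < Real.log d := hl2.trans_le (Real.log_le_log (by norm_num) hd')
  have hlog : Real.log 2 * Real.logb 2 d = Real.log d := by
    rw [Real.logb]; field_simp
  set B := 27 * Real.log 2 * (d : ℝ) ^ 6 * Real.logb 2 d / (n * δ ^ 3) with hB
  have hBe : B = 27 * d ^ 6 * Real.log d / (n * δ ^ 3) := by rw [hB, ← hlog]; ring
  have hB0 : 0 ≤ B := by rw [hBe]; positivity
  set η := B ^ (1 / 3 : ℝ)
  have hη : η ^ 3 = B := by
    rw [← Real.rpow_natCast, ← Real.rpow_mul hB0]; norm_num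
  by_contra hc
  push Not at hc
  have h1 : (δ * n) * η ^ 2 ≤ 4 * (d : ℝ) ^ 4 := by
    refine le_trans ?_ h
    gcongr
  have h2 : ((δ * n) * η ^ 2) ^ 3 ≤ (4 * (d : ℝ) ^ 4) ^ 3 := by gcongr
  have h3 : ((δ * n) * η ^ 2) ^ 3 = 729 * n * Real.log d ^ 2 / δ ^ 3 * d ^ 12 := by
    have : ((δ * n) * η ^ 2) ^ 3 = (δ * n) ^ 3 * (η ^ 3) ^ 2 := by ring
    rw [this, hη, hBe]
    field_simp
    ring
  have h4 : (4 * (d : ℝ) ^ 4) ^ 3 = 64 * d ^ 12 := by ring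
  rw [h3, h4] at h2
  have h5 := le_of_mul_le_mul_right h2 (by positivity)
  rw [div_le_iff₀ (by positivity)] at h5
  have h6 : δ ^ 3 ≤ 1 := pow_le_one₀ hδ.le hδ1
  have h7 : 0.69 ^ 2 ≤ Real.log d ^ 2 := by gcongr
  nlinarith [mul_le_mul hn' h7 (by norm_num) (by linarith)]

lemma isPOVM_one : IsPOVM (fun _ : Fin 1 => (1 : Op (Fin d))) :=
  ⟨fun _ => zero_le_one, by simp⟩

lemma diamondNorm_zero : diamondNorm (fun _ : Op (Fin d) => (0 : Op κ)) = 0 := by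
  simp [diamondNorm, ampliation, traceNorm_zero]

/-- Operators on a one-dimensional space are scalars, so the reduced map only prepares the marginal
of Λ(1) and the approximation is exact. -/
lemma IsPositiveTP.exists_state_diamondNorm_eq_zero {Λ : Op (Fin 1) →ₗ[ℂ] Op (∀ i, β i)}
    (hΛ : IsPositiveTP Λ) (j : Fin n) : ∃ σ : Fin 1 → Op (β j), (∀ k, IsState (σ k)) ∧
      diamondNorm (fun X => marginal j (Λ X) - measurePrepare (fun _ => 1) σ X) = 0 := by
  have htr : trace (1 : Op (Fin 1)) = 1 := by
    have := hΛ.mass_one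
    rw [← hΛ.pairing_one, ← hΛ.ofReal_mass zero_le_one, this]
    simp
  have hσ : IsState (marginal j (Λ 1)) := by
    have := isState_partialTrace (Equiv.piSplitAt j β) (hΛ.nonneg 1 zero_le_one)
      (hΛ.isTraceClass 1) one_pos (by rw [(hΛ.tracePreserving 1).2, htr]; simp)
    rw [Complex.ofReal_one, inv_one, one_smul] at this
    exact this
  refine ⟨fun _ => marginal j (Λ 1), fun _ => hσ, ?_⟩
  convert diamondNorm_zero (d := 1) (κ := β j) using 3 with X
  have hX : X = trace X • 1 := by
    conv_lhs => rw [eq_sum_matrixUnit X]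
    rw [one_eq_sum_matrixUnit, trace]
    simp [inner_ket_left]
  have h2 : marginal j (Λ X) = trace X • marginal j (Λ 1) := by
    conv_lhs => rw [hX, map_smul]
    exact partialTrace_smul (Equiv.piSplitAt j β) _ (hΛ.mem_traceClassSpan 1)
  rw [h2]
  simp [measurePrepare]

end

end QDarwinism

end

theorem theorem1 {d n : ℕ} (hd : 0 < d) {β : Fin n → Type*}
    (Λ : QDarwinism.Op (Fin d) →CP QDarwinism.Op (∀ j, β j))
    (hΛ : QDarwinism.IsTracePreserving Λ) (δ : ℝ) (hδ : 0 < δ) :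
    ∃ (m : ℕ) (M : Fin m → QDarwinism.Op (Fin d)) (S : Finset (Fin n)),
      QDarwinism.IsPOVM M ∧ (1 - δ) * n ≤ (S.card : ℝ) ∧
      ∀ j ∈ S, ∃ σ : Fin m → QDarwinism.Op (β j),
        (∀ k, QDarwinism.IsState (σ k)) ∧
        QDarwinism.diamondNorm
            (fun X => QDarwinism.marginal j (Λ X) - QDarwinism.measurePrepare M σ X) ≤
          ENNReal.ofReal
            ((27 * Real.log 2 * (d : ℝ) ^ 6 * Real.logb 2 d / (n * δ ^ 3)) ^ (1 / 3 : ℝ)) := by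
  have hP : QDarwinism.IsPositiveTP Λ.toLinearMap := ⟨fun X hX => map_nonneg Λ hX, hΛ⟩
  rcases le_or_gt n 0 with hn | hn
  · obtain rfl : n = 0 := by omega
    exact ⟨1, _, ∅, QDarwinism.isPOVM_one, by simp, by simp⟩
  rcases lt_or_ge 1 δ with hδ1 | hδ1
  · refine ⟨1, _, ∅, QDarwinism.isPOVM_one, ?_, by simp⟩
    rw [Finset.card_empty, Nat.cast_zero]
    exact mul_nonpos_of_nonpos_of_nonneg (by linarith) (Nat.cast_nonneg n)
  -- For d = 1 the logarithm makes the bound zero, while the greedy argument needs η > 0.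
  rcases le_or_gt d 1 with hd1 | hd1
  · obtain rfl : d = 1 := by omega
    refine ⟨1, _, Finset.univ, QDarwinism.isPOVM_one, ?_, fun j _ => ?_⟩
    · rw [Finset.card_univ, Fintype.card_fin]
      exact mul_le_of_le_one_left (Nat.cast_nonneg n) (by linarith)
    · obtain ⟨σ, hσ, h⟩ := hP.exists_state_diamondNorm_eq_zero j
      exact ⟨σ, hσ, h.trans_le zero_le⟩
  have hn' : (0 : ℝ) < n := by exact_mod_cast hn
  have hd' : (1 : ℝ) < d := by exact_mod_cast hd1
  have hη : 0 < (27 * Real.log 2 * (d : ℝ) ^ 6 * Real.logb 2 d / (n * δ ^ 3)) ^ (1 / 3 : ℝ) := by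
    have := Real.logb_pos one_lt_two hd'
    have := Real.log_pos one_lt_two
    positivity
  obtain ⟨C, m, M, hM, hC, hCσ⟩ := QDarwinism.exists_povm_diamondNorm_le hP hd hη
  refine ⟨m, M, Cᶜ, hM, ?_, fun j hj => hCσ j (Finset.mem_compl.1 hj)⟩
  have h := QDarwinism.card_le_of_mul_sq_le hd1 hn hδ hδ1 hC
  rw [Finset.card_compl, Fintype.card_fin, Nat.cast_sub (C.card_le_univ.trans_eq (by simp))]
  linarith
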